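/- **Setting.** An episodic MDP $M$ with horizon $H$ on finite spaces $\mathcal S,\mathcal A$ has transition kernels $\mathbb P_h(\cdot\mid x,a)$ and random rewards with values in $[0,1]$ and mean $r_h(x,a)$, $h\in[H]$. It is a *linear MDP* with feature map $\phi:\mathcal S\times\mathcal A\to\mathbb R^d$ if $\|\phi(x,a)\|\le 1$ for all $(x,a)$ and for each $h$ there are a $d$-tuple $\mu_h$ of signed measures on $\mathcal S$ and $\theta_h\in\mathbb R^d$ with $\mathbb P_h(\cdot\mid x,a)=\langle\phi(x,a),\mu_h(\cdot)\rangle$, $r_h(x,a)=\langle\phi(x,a),\theta_h\rangle$ for all $(x,a)$ and $\max\{\|\mu_h(\mathcal S)\|,\|\theta_h\|\}\le\sqrt d$. A policy $\pi=\{\pi_h\}$ assigns to each $h$ and $x$ a distribution $\pi_h(\cdot\mid x)$ on $\mathcal A$; $V_h^\pi(x)$ is the expected sum of the rewards of steps $h,\dots,H$ under $\pi$ from $x_h=x$ (with $V^\pi_{H+1}=0$), $V_h^*=\sup_\pi V_h^\pi$, and $\pi$ is optimal if $V_h^{\pi}=V_h^*$ for all $h$. Put $[\mathbb V_hV](x,a)=\max\{1,\operatorname{Var}_{x'\sim\mathbb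 P_h(\cdot\mid x,a)}V(x')\}$ and $\|u\|_\Lambda=\sqrt{u^\top\Lambda u}$. **Theorem 3 (Lower bound for MDPs).** There are universal constants $c,c_0,C>0$ such that for all integers $H\ge1$, $d\ge2$, $K$ and all $\delta\in(0,1)$ with $K\ge C\,d^4\log(2Hd/\delta)$ there exist finite spaces $\mathcal S,\mathcal A$, a feature map $\phi$, an initial distribution $\xi$, a behavior policy $\beta$ and a nonempty class $\mathcal M$ of linear MDPs with feature map $\phi$, such that the following holds for the dataset $\mathcal D=\{(x_h^\tau,a_h^\tau,r_h^\tau)\}_{h\in[H],\tau\in[K]}$ of $K$ independent trajectories collected by $\beta$ from $x_1\sim\xi$. (i) For every $M\in\mathcal M$ and $h\in[H]$, the covariance matrix of the features at step $h$ under $\beta$ satisfies $\lambda_{\min}\big(\mathbb E_{\beta,h}[\phi\phi^\top]\big)\ge c_0/d^2$, and $M$ has an optimal policy. (ii) For every (measurable) data-dependent policy $\widehat\pi=\widehat\pi(\mathcal D)$, every $\lambda>0$, every $M\in\mathcal M$ and every optimal policy $\pi^*$ of $M$, with probability at least $1-\delta$ over $\mathcal D$ collected in $M$, $$\sup_{M'\in\mathcal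 M}\mathbb E_{M'}\big[V_1^*(x_1)-V_1^{\widehat\pi}(x_1)\big]\;\ge\;c\sqrt d\,\sum_{h=1}^H\mathbb E_{\pi^*}\|\phi(x_h,a_h)\|_{(\mathbf Z_h^*)^{-1}},$$ where $$\mathbf Z_h^*=\sum_{\tau=1}^K\frac{\phi(x_h^\tau,a_h^\tau)\phi(x_h^\tau,a_h^\tau)^\top}{[\mathbb V_hV_{h+1}^*](x_h^\tau,a_h^\tau)}+\lambda I_d .$$ On the left the values are those of $M'$, and $\mathbb E_{M'}$ is over the dataset collected in $M'$ and an independent $x_1\sim\xi$; on the right $\mathbb E_{\pi^*}$, $V^*$ and $\mathbb V_h$ are those of $M$, and $\mathbb E_{\pi^*}$ is over $x_1\sim\xi$ and the trajectory of $\pi^*$. -/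

import Mathlib

open MeasureTheory
open scoped Matrix

noncomputable section

namespace OfflineRL

/-- Markov policies for horizon `H`: `π h x` is a probability vector on the actions.
Steps are numbered `0, …, H - 1`. -/
abbrev Policy (H : ℕ) (S A : Type) [Fintype A] : Type :=
  {π : Fin H → S → A → ℝ // ∀ h x, π h x ∈ stdSimplex ℝ A}

/-- An episodic MDP with horizon `H` on finite state and action spaces. The reward observed
at `(x, a)` in step `h` is drawn from the law `R h x a` on `[0, 1]`; a deterministic reward is
the case of a Dirac measure. -/
structure MDP (H : ℕ) (S A : Type) [Fintype S] where
  /-- `P h x a x'` is the probability to move from `x` to `x'` under `a` in step `h` -/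
  P : Fin H → S → A → S → ℝ
  P_mem : ∀ h x a, P h x a ∈ stdSimplex ℝ S
  /-- law of the observed reward -/
  R : Fin H → S → A → Measure ℝ
  R_prob : ∀ h x a, IsProbabilityMeasure (R h x a)
  R_mem : ∀ h x a, ∀ᵐ r ∂(R h x a), r ∈ Set.Icc (0 : ℝ) 1

/-- A trajectory `(x_h, a_h, r_h)_h`. -/
abbrev Traj (H : ℕ) (S A : Type) : Type := Fin H → (S × A) × ℝ

/-- A dataset of `K` trajectories. -/
abbrev Dataset (K H : ℕ) (S A : Type) : Type := Fin K → Traj H S A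

/-- The weighted norm `‖u‖_Λ = √(uᵀ Λ u)`. -/
def wnorm {d : ℕ} (Λ : Matrix (Fin d) (Fin d) ℝ) (u : EuclideanSpace ℝ (Fin d)) : ℝ :=
  √(u.ofLp ⬝ᵥ (Λ *ᵥ u.ofLp))

namespace MDP

variable {H : ℕ} {S A : Type} [Fintype S] [Fintype A]

/-- The expected reward `r_h(x, a)`. -/
def r (M : MDP H S A) (h : Fin H) (x : S) (a : A) : ℝ := ∫ y, y ∂(M.R h x a)

/-- `(P_h V)(x, a)`. -/
def PV (M : MDP H S A) (h : Fin H) (V : S → ℝ) (x : S) (a : A) : ℝ :=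
  ∑ x', M.P h x a x' * V x'

/-- Conditional variance `[Var_h V](x, a)`. -/
def condVar (M : MDP H S A) (h : Fin H) (V : S → ℝ) (x : S) (a : A) : ℝ :=
  M.PV h (fun x' => V x' ^ 2) x a - (M.PV h V x a) ^ 2

/-- Truncated variance `max {1, [Var_h V](x, a)}`. -/
def truncVar (M : MDP H S A) (h : Fin H) (V : S → ℝ) (x : S) (a : A) : ℝ :=
  max 1 (M.condVar h V x a)

/-- `M.value π h x` is the expected sum of the rewards of the steps `h, …, H - 1` under `π`,
started from `x` at step `h`; it is `0` for `h ≥ H`. -/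
def value (M : MDP H S A) (π : Policy H S A) (h : ℕ) (x : S) : ℝ :=
  if hh : h < H then
    ∑ a, π.1 ⟨h, hh⟩ x a *
      (M.r ⟨h, hh⟩ x a + ∑ x', M.P ⟨h, hh⟩ x a x' * M.value π (h + 1) x')
  else 0
termination_by H - h

/-- The optimal value `V*_h(x)`: the supremum over all policies. -/
def optValue (M : MDP H S A) (h : ℕ) (x : S) : ℝ := ⨆ π : Policy H S A, M.value π h x

/-- `π` attains the optimal value at every step and every state. -/
def IsOptimal (M : MDP H S A) (π : Policy H S A) : Prop :=
  ∀ (h : Fin H) (x : S) (π' : Policy H S A), M.value π' h x ≤ M.value π h x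

/-- Linear MDP with feature map `φ`. On a finite state space a `d`-tuple of signed measures is a
map `μ : S → ℝᵈ`, and its value on the whole space is `∑ x', μ x'`. -/
def IsLinear {d : ℕ} (M : MDP H S A) (φ : S → A → EuclideanSpace ℝ (Fin d)) : Prop :=
  (∀ x a, ‖φ x a‖ ≤ 1) ∧
  ∀ h, ∃ (μ : S → EuclideanSpace ℝ (Fin d)) (θ : EuclideanSpace ℝ (Fin d)),
    (∀ x a x', M.P h x a x' = inner ℝ (φ x a) (μ x')) ∧
    (∀ x a, M.r h x a = inner ℝ (φ x a) θ) ∧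
    ‖∑ x', μ x'‖ ≤ √(d : ℝ) ∧ ‖θ‖ ≤ √(d : ℝ)

/-- Probability of the state-action path `s` when `x_0 ∼ ξ`, `a_h ∼ π_h(· | x_h)` and
`x_{h+1} ∼ P_h(· | x_h, a_h)`. -/
def pathProb (M : MDP H S A) (ξ : S → ℝ) (π : Policy H S A) (s : Fin H → S × A) : ℝ :=
  ∏ h : Fin H,
    (if h.val = 0 then ξ (s h).1
      else
        let g : Fin H := ⟨h.val - 1, lt_of_le_of_lt (Nat.sub_le _ _) h.isLt⟩
        M.P g (s g).1 (s g).2 (s h).1)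
    * π.1 h (s h).1 (s h).2

/-- `E_π[f(x_h, a_h)]` with `x_0 ∼ ξ`. -/
def expect (M : MDP H S A) (ξ : S → ℝ) (π : Policy H S A) (h : Fin H) (f : S → A → ℝ) : ℝ :=
  ∑ s : Fin H → S × A, M.pathProb ξ π s * f (s h).1 (s h).2

/-- The covariance matrix `E_{π,h}[φ(x, a) φ(x, a)ᵀ]`. -/
def covMatrix {d : ℕ} (M : MDP H S A) (φ : S → A → EuclideanSpace ℝ (Fin d)) (ξ : S → ℝ)
    (π : Policy H S A) (h : Fin H) : Matrix (Fin d) (Fin d) ℝ :=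
  Matrix.of fun i j => M.expect ξ π h fun x a => φ x a i * φ x a j

/-- `Z*_h = ∑_τ φ(x_h^τ, a_h^τ) φ(x_h^τ, a_h^τ)ᵀ / max {1, [Var_h V*_{h+1}](x_h^τ, a_h^τ)} + lam I`
for the dataset `D`. -/
def Zstar {d K : ℕ} (M : MDP H S A) (φ : S → A → EuclideanSpace ℝ (Fin d)) (lam : ℝ)
    (D : Dataset K H S A) (h : Fin H) : Matrix (Fin d) (Fin d) ℝ :=
  (∑ τ : Fin K,
    (M.truncVar h (M.optValue (h.val + 1)) (D τ h).1.1 (D τ h).1.2)⁻¹ •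
      Matrix.vecMulVec (φ (D τ h).1.1 (D τ h).1.2).ofLp (φ (D τ h).1.1 (D τ h).1.2).ofLp)
  + lam • (1 : Matrix (Fin d) (Fin d) ℝ)

variable [MeasurableSpace S] [MeasurableSpace A]

/-- Law of one trajectory collected by the policy `π`: a state-action path drawn with
probability `pathProb`, and, given the path, independent rewards `r_h ∼ R h x_h a_h`. -/
def trajLaw (M : MDP H S A) (ξ : S → ℝ) (π : Policy H S A) : Measure (Traj H S A) :=
  ∑ s : Fin H → S × A, ENNReal.ofReal (M.pathProb ξ π s) •
    Measure.pi fun h => (Measure.dirac (s h)).prod (M.R h (s h).1 (s h).2)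

/-- Law of a dataset of `K` independent trajectories collected by the policy `π`. -/
def dataLaw (M : MDP H S A) (K : ℕ) (ξ : S → ℝ) (π : Policy H S A) :
    Measure (Dataset K H S A) :=
  Measure.pi fun _ => M.trajLaw ξ π

/-- The expected suboptimality `E_M[V*_1(x_1) - V_1^{π̂}(x_1)]` of the data-dependent policy
`alg`, for a dataset collected by `β` and an independent initial state `x_1 ∼ ξ`. -/
def expSubopt {K : ℕ} (M : MDP H S A) (ξ : S → ℝ) (β : Policy H S A)
    (alg : Dataset K H S A → Policy H S A) : ℝ :=
  ∫ D, ∑ x, ξ x * (M.optValue 0 x - M.value (alg D) 0 x) ∂(M.dataLaw K ξ β)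

end MDP

end OfflineRL

end

/-!
The hard instances redraw the state independently in every step, so that only the rewards matter
and every value function is constant, with truncated variance `1`. Let `n = d - 1`. The actions are
the points of the cube `{0, 1}ⁿ`, and the reward of `a` in step `h` is Bernoulli with mean
`1 / 2 + ε ∑ i, ± a i`, where the signs are hidden bits `u (h, i)`; the best action plays exactly
the coordinates with a positive sign. The behavior policy probes the origin with probability
`1 / 2` and each unit vector with probability `1 / (2 n)`, so that only about `K / (2 n)` rewards
depend on a given bit. For `ε` of order `√(n / K)`, flipping one bit therefore leaves the law of the
dataset at bounded Hellinger distance, and Assouad's lemma yields an instance on which the algorithm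
gets a constant fraction of the `H n` bits wrong, each at cost `ε`.

Conversely, as soon as every probing action has been played at least half as often as expected,
which a Chernoff bound makes likely, `Z*` is bounded below by the design of the probes and
`‖φ(x, a)‖` in the norm of its inverse is at most `√(8 n² / K)`. Then `√d` times the sum of these
norms over the `H` steps is of the same order `ε H n`.
-/

noncomputable section

namespace OfflineRL

/-! ### Weights on finite types -/

section Weights

variable {ι Ω Y Z : Type*}

/-- The weight of a tuple `f` whose coordinates are independent, the `i`-th with weights `p i`. -/
def productWeight [Fintype ι] (p : ι → Y → ℝ) (f : ι → Y) : ℝ := ∏ i, p i (f i)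

/-- The weight of a pair whose first component has weights `ν` and whose second component has,
given the first one, the weights `κ z`. -/
def compWeight (ν : Z → ℝ) (κ : Z → Y → ℝ) (y : Z × Y) : ℝ := ν y.1 * κ y.1 y.2

lemma productWeight_nonneg [Fintype ι] {p : ι → Y → ℝ} (hp : ∀ i y, 0 ≤ p i y) (f : ι → Y) :
    0 ≤ productWeight p f :=
  Finset.prod_nonneg fun i _ => hp i (f i)

lemma sum_card_fiber_mul_le [Fintype ι] {O : Type*} [Fintype O] [DecidableEq Y] (a : ι → Y)
    {g : O → Y} (hg : Function.Injective g) {f : Y → ℝ} (hf : ∀ y, 0 ≤ f y) :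
    ∑ o, (Finset.card {τ | a τ = g o} : ℝ) * f (g o) ≤ ∑ τ, f (a τ) := by
  have hfiber : ∀ o, (Finset.card {τ | a τ = g o} : ℝ) * f (g o) =
      ∑ τ, if a τ = g o then f (a τ) else 0 := fun o => by
    rw [← Finset.sum_filter, Finset.sum_congr rfl fun τ hτ => by rw [(Finset.mem_filter.1 hτ).2],
      Finset.sum_const, nsmul_eq_mul]
  simp only [hfiber]
  rw [Finset.sum_comm]
  refine Finset.sum_le_sum fun τ _ => ?_
  by_cases h : ∃ o, a τ = g o
  · obtain ⟨o, ho⟩ := h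
    rw [Finset.sum_eq_single o (fun _ _ hne => if_neg fun h => hne (hg (h.symm.trans ho)))
      (by simp)]
    exact (if_pos ho).le
  · exact (Finset.sum_eq_zero fun o _ => if_neg fun ho => h ⟨o, ho⟩).trans_le (hf _)

variable [Fintype Ω] [Fintype Y] [Fintype Z]

section Product

variable [Fintype ι] [DecidableEq ι] {p : ι → Y → ℝ}

lemma sum_productWeight_mul_prod (p g : ι → Y → ℝ) :
    ∑ f, productWeight p f * ∏ i, g i (f i) = ∏ i, ∑ y, p i y * g i y := by
  simp only [productWeight, Fintype.prod_sum, Finset.prod_mul_distrib]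

lemma productWeight_mem_stdSimplex (hp : ∀ i, p i ∈ stdSimplex ℝ Y) :
    productWeight p ∈ stdSimplex ℝ (ι → Y) := by
  refine ⟨productWeight_nonneg fun i => (hp i).1, ?_⟩
  simpa [(hp _).2] using sum_productWeight_mul_prod p fun _ _ => 1

lemma sum_productWeight_mul_apply (hp : ∀ i, ∑ y, p i y = 1) (g : Y → ℝ) (i : ι) :
    ∑ f, productWeight p f * g (f i) = ∑ y, p i y * g y := by
  have h := sum_productWeight_mul_prod p fun j y => if j = i then g y else 1
  simp only [Finset.prod_ite_eq', Finset.mem_univ, if_true] at h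
  rw [h, Finset.prod_eq_single i (fun j _ hj => by simp [hj, hp]) (by simp)]
  simp only [if_true]

end Product

lemma sum_compWeight_mul (ν : Z → ℝ) (κ : Z → Y → ℝ) (g : Z × Y → ℝ) :
    ∑ y, compWeight ν κ y * g y = ∑ z, ν z * ∑ y, κ z y * g (z, y) := by
  simp only [compWeight, Fintype.sum_prod_type, Finset.mul_sum, mul_assoc]

lemma compWeight_mem_stdSimplex {ν : Z → ℝ} {κ : Z → Y → ℝ} (hν : ν ∈ stdSimplex ℝ Z)
    (hκ : ∀ z, κ z ∈ stdSimplex ℝ Y) : compWeight ν κ ∈ stdSimplex ℝ (Z × Y) := by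
  refine ⟨fun y => mul_nonneg (hν.1 _) ((hκ _).1 _), ?_⟩
  simpa [(hκ _).2, hν.2] using sum_compWeight_mul ν κ fun _ => 1

lemma sum_filter_eq_sum_mul_boole (p : Ω → ℝ) (B : Ω → Prop) [DecidablePred B] :
    ∑ ω with B ω, p ω = ∑ ω, p ω * if B ω then 1 else 0 := by
  simp only [Finset.sum_filter, mul_boole]

lemma one_sub_sum_le_sum_filter_forall_not [Fintype ι] {p : Ω → ℝ} (hp : p ∈ stdSimplex ℝ Ω)
    {B : ι → Ω → Prop} [∀ i, DecidablePred (B i)] {η : ι → ℝ}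
    (hB : ∀ i, ∑ ω with B i ω, p ω ≤ η i) :
    1 - ∑ i, η i ≤ ∑ ω with ∀ i, ¬B i ω, p ω := by
  have hcover : ∀ ω, p ω ≤ (if ∀ i, ¬B i ω then p ω else 0) + ∑ i, if B i ω then p ω else 0 := by
    intro ω
    have hnonneg : ∀ i, 0 ≤ if B i ω then p ω else 0 := fun i => by split_ifs <;> simp [hp.1]
    split_ifs with h
    · exact le_add_of_nonneg_right (Finset.sum_nonneg fun i _ => hnonneg i)
    · obtain ⟨i, hi⟩ := not_forall_not.1 h
      rw [zero_add]
      exact (if_pos hi).ge.trans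
        (Finset.single_le_sum (fun j _ => hnonneg j) (Finset.mem_univ i))
  have hsum := Finset.sum_le_sum fun ω (_ : ω ∈ Finset.univ) => hcover ω
  rw [hp.2, Finset.sum_add_distrib, Finset.sum_comm] at hsum
  simp only [← Finset.sum_filter] at hsum
  linarith [Finset.sum_le_sum fun i (_ : i ∈ Finset.univ) => hB i]

section Chernoff

variable {p : Y → ℝ} (hp : p ∈ stdSimplex ℝ Y) {B : Y → Prop} [DecidablePred B] {ρ : ℝ}
  (hρ : ρ ≤ ∑ y with B y, p y)

include hp hρ

lemma sum_mul_exp_neg_indicator_le :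
    ∑ y, p y * Real.exp (if B y then -1 else 0) ≤ Real.exp (-(3 / 5 * ρ)) := by
  have hexp : Real.exp (-1) ≤ 2 / 5 := by
    rw [Real.exp_neg, inv_le_comm₀ (Real.exp_pos _) (by norm_num)]
    linarith [Real.exp_one_gt_d9]
  have hsplit : ∑ y, p y * Real.exp (if B y then -1 else 0) =
      1 - (1 - Real.exp (-1)) * ∑ y with B y, p y := by
    rw [eq_sub_iff_add_eq, Finset.sum_filter, Finset.mul_sum, ← Finset.sum_add_distrib]
    refine (Finset.sum_congr rfl fun y _ => ?_).trans hp.2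
    split_ifs
    · ring
    · simp
  have hnonneg : 0 ≤ ∑ y with B y, p y := Finset.sum_nonneg fun y _ => hp.1 y
  nlinarith [Real.add_one_le_exp (-(3 / 5 * ρ))]

lemma sum_productWeight_card_lt_le [Fintype ι] [DecidableEq ι] :
    ∑ ω with (Finset.card {τ : ι | B (ω τ)} : ℝ) < Fintype.card ι * ρ / 2,
      productWeight (fun _ => p) ω ≤ Real.exp (-(Fintype.card ι * ρ / 10)) := by
  set N : (ι → Y) → ℝ := fun ω => (Finset.card {τ : ι | B (ω τ)} : ℝ)
  set t : ℝ := Fintype.card ι * ρ / 2 with ht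
  have hw : ∀ ω : ι → Y, 0 ≤ productWeight (fun _ => p) ω := productWeight_nonneg fun _ => hp.1
  have hmgf : ∑ ω, productWeight (fun _ : ι => p) ω * Real.exp (-N ω) =
      (∑ y, p y * Real.exp (if B y then -1 else 0)) ^ Fintype.card ι := by
    rw [← Finset.card_univ, ← Finset.prod_const, ← sum_productWeight_mul_prod]
    refine Finset.sum_congr rfl fun ω _ => ?_
    rw [← Real.exp_sum, ← Finset.sum_filter, Finset.sum_const, nsmul_eq_mul, mul_neg_one]
  calc ∑ ω with N ω < t, productWeight (fun _ => p) ω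
      ≤ ∑ ω with N ω < t, productWeight (fun _ => p) ω * Real.exp (t - N ω) := by
        refine Finset.sum_le_sum fun ω hω => le_mul_of_one_le_right (hw ω) ?_
        exact Real.one_le_exp (sub_nonneg.2 (Finset.mem_filter.1 hω).2.le)
    _ ≤ ∑ ω, productWeight (fun _ => p) ω * Real.exp (t - N ω) :=
        Finset.sum_le_univ_sum_of_nonneg fun ω => mul_nonneg (hw ω) (Real.exp_pos _).le
    _ = Real.exp t * (∑ y, p y * Real.exp (if B y then -1 else 0)) ^ Fintype.card ι := by
        simp only [← hmgf, Finset.mul_sum, sub_eq_add_neg, Real.exp_add, mul_left_comm]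
    _ ≤ Real.exp t * Real.exp (-(3 / 5 * ρ)) ^ Fintype.card ι := by
        gcongr
        · exact Finset.sum_nonneg fun y _ => mul_nonneg (hp.1 y) (Real.exp_pos _).le
        · exact sum_mul_exp_neg_indicator_le hp hρ
    _ = Real.exp (-(Fintype.card ι * ρ / 10)) := by
        rw [← Real.exp_nat_mul, ← Real.exp_add, ht]
        congr 1
        ring

end Chernoff

end Weights

/-! ### Finitely supported measures -/

section WeightedDirac

variable {Ω X Y Z : Type*} [Fintype Ω] [Fintype Y] [Fintype Z] [MeasurableSpace X]

/-- The law of `g ω` when `ω` has the weights `p`. -/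
def weightedDirac (p : Ω → ℝ) (g : Ω → X) : Measure X :=
  ∑ ω, ENNReal.ofReal (p ω) • Measure.dirac (g ω)

instance (p : Ω → ℝ) (g : Ω → X) : IsFiniteMeasure (weightedDirac p g) :=
  ⟨by simp [weightedDirac, Measure.finsetSum_apply, ENNReal.sum_lt_top]⟩

lemma pi_dirac {ι : Type*} [Fintype ι] {X : ι → Type*} [∀ i, MeasurableSpace (X i)]
    (x : ∀ i, X i) : Measure.pi (fun i => Measure.dirac (x i)) = Measure.dirac x := by
  classical
  refine Measure.pi_eq fun s hs => ?_
  simp only [Measure.dirac_apply' _ (MeasurableSet.univ_pi hs), Measure.dirac_apply' _ (hs _),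
    Set.indicator, Set.mem_univ_pi, Pi.one_apply, Finset.prod_ite_zero, Finset.mem_univ,
    true_imp_iff, Finset.prod_const_one]

lemma pi_sum_smul {ι κ : Type*} [Fintype ι] [DecidableEq ι] [Fintype κ] {X : ι → Type*}
    [∀ i, MeasurableSpace (X i)] {w : ι → κ → ENNReal} (hw : ∀ i k, w i k ≠ ⊤)
    (m : ∀ i, κ → Measure (X i)) [∀ i k, IsFiniteMeasure (m i k)] :
    Measure.pi (fun i => ∑ k, w i k • m i k) =
      ∑ f : ι → κ, (∏ i, w i (f i)) • Measure.pi (fun i => m i (f i)) := by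
  have hfinite : ∀ i, IsFiniteMeasure (∑ k, w i k • m i k) := fun i => ⟨by
    rw [Measure.finsetSum_apply]
    exact ENNReal.sum_lt_top.2 fun k _ => ENNReal.mul_lt_top (hw i k).lt_top (measure_lt_top _ _)⟩
  refine Measure.pi_eq fun s _ => ?_
  simp only [Measure.finsetSum_apply, Measure.smul_apply, Measure.pi_pi, smul_eq_mul,
    ← Finset.prod_mul_distrib, Fintype.prod_sum]

lemma pi_weightedDirac {ι : Type*} [Fintype ι] [DecidableEq ι] {p : ι → Ω → ℝ}
    (hp : ∀ i ω, 0 ≤ p i ω) (g : ι → Ω → X) :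
    Measure.pi (fun i => weightedDirac (p i) (g i)) =
      weightedDirac (productWeight p) fun f i => g i (f i) := by
  simp only [weightedDirac, productWeight, pi_sum_smul fun _ _ => ENNReal.ofReal_ne_top, pi_dirac,
    ENNReal.ofReal_prod_of_nonneg fun i _ => hp i _]

lemma weightedDirac_compWeight {ν : Z → ℝ} (hν : ∀ z, 0 ≤ ν z) [MeasurableSpace Z]
    (κ : Z → Y → ℝ) (g : Y → X) :
    weightedDirac (compWeight ν κ) (fun y => (y.1, g y.2)) =
      ∑ z, ENNReal.ofReal (ν z) • (Measure.dirac z).prod (weightedDirac (κ z) g) := by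
  have hprod : ∀ z, (Measure.dirac z).prod (weightedDirac (κ z) g) =
      ∑ y, ENNReal.ofReal (κ z y) • Measure.dirac (z, g y) := fun z => by
    rw [Measure.dirac_prod, weightedDirac,
      Measure.map_finset_sum measurable_prodMk_left.aemeasurable]
    simp only [Measure.map_smul, Measure.map_dirac' measurable_prodMk_left]
  simp only [hprod]
  simp only [weightedDirac, compWeight, Fintype.sum_prod_type, Finset.smul_sum, smul_smul,
    ENNReal.ofReal_mul (hν _)]

variable {p : Ω → ℝ}

lemma isProbabilityMeasure_weightedDirac (hp : p ∈ stdSimplex ℝ Ω) (g : Ω → X) :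
    IsProbabilityMeasure (weightedDirac p g) :=
  ⟨by simp [weightedDirac, Measure.finsetSum_apply,
    ← ENNReal.ofReal_sum_of_nonneg fun ω _ => hp.1 ω, hp.2]⟩

lemma integral_weightedDirac [MeasurableSingletonClass X] (hp : ∀ ω, 0 ≤ p ω) (g : Ω → X)
    (f : X → ℝ) : ∫ x, f x ∂(weightedDirac p g) = ∑ ω, p ω * f (g ω) := by
  rw [weightedDirac, integral_finsetSum_measure fun ω _ =>
    (integrable_dirac enorm_lt_top).smul_measure ENNReal.ofReal_ne_top]
  simp only [integral_smul_measure, ENNReal.toReal_ofReal (hp _), integral_dirac, smul_eq_mul]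

lemma ofReal_sum_le_weightedDirac_apply [MeasurableSingletonClass X] (hp : ∀ ω, 0 ≤ p ω)
    {g : Ω → X} {E : Set X} {s : Finset Ω} (hs : ∀ ω ∈ s, g ω ∈ E) :
    ENNReal.ofReal (∑ ω ∈ s, p ω) ≤ weightedDirac p g E := by
  rw [weightedDirac, Measure.finsetSum_apply, ENNReal.ofReal_sum_of_nonneg fun ω _ => hp ω]
  calc ∑ ω ∈ s, ENNReal.ofReal (p ω)
      = ∑ ω ∈ s, (ENNReal.ofReal (p ω) • Measure.dirac (g ω)) E :=
        Finset.sum_congr rfl fun ω hω => by simp [hs ω hω]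
    _ ≤ _ := Finset.sum_le_univ_sum_of_nonneg fun ω => bot_le

end WeightedDirac

/-! ### The methods of Le Cam and Assouad -/

section Affinity

variable {Ω : Type*} [Fintype Ω]

/-- The Hellinger affinity (Bhattacharyya coefficient) of two weights on a finite type. Unlike
the total variation distance, it is multiplicative on products. -/
def affinity (p q : Ω → ℝ) : ℝ := ∑ ω, √(p ω * q ω)

lemma affinity_self {p : Ω → ℝ} (hp : p ∈ stdSimplex ℝ Ω) : affinity p p = 1 := by
  simp only [affinity, Real.sqrt_mul_self (hp.1 _), hp.2]

lemma affinity_productWeight {ι : Type*} [Fintype ι] [DecidableEq ι] {p q : ι → Ω → ℝ}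
    (hp : ∀ i ω, 0 ≤ p i ω) (hq : ∀ i ω, 0 ≤ q i ω) :
    affinity (productWeight p) (productWeight q) = ∏ i, affinity (p i) (q i) := by
  simp only [affinity, productWeight, Fintype.prod_sum, ← Finset.prod_mul_distrib,
    Real.sqrt_prod _ fun i _ => mul_nonneg (hp i _) (hq i _)]

lemma affinity_compWeight {Z : Type*} [Fintype Z] {ν : Z → ℝ} (hν : ∀ z, 0 ≤ ν z)
    (κ κ' : Z → Ω → ℝ) :
    affinity (compWeight ν κ) (compWeight ν κ') = ∑ z, ν z * affinity (κ z) (κ' z) := by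
  simp only [affinity, compWeight, Fintype.sum_prod_type, Finset.mul_sum, mul_mul_mul_comm (ν _),
    Real.sqrt_mul (mul_self_nonneg (ν _)), Real.sqrt_mul_self (hν _)]

lemma sq_affinity_le_two_mul_sum_min {p q : Ω → ℝ} (hp : p ∈ stdSimplex ℝ Ω)
    (hq : q ∈ stdSimplex ℝ Ω) : affinity p q ^ 2 ≤ 2 * ∑ ω, min (p ω) (q ω) := by
  have hmin : ∀ ω, 0 ≤ min (p ω) (q ω) := fun ω => le_min (hp.1 ω) (hq.1 ω)
  have hmax : ∀ ω, 0 ≤ max (p ω) (q ω) := fun ω => (hp.1 ω).trans (le_max_left _ _)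
  have hmax_sum : ∑ ω, max (p ω) (q ω) ≤ 2 := by
    calc ∑ ω, max (p ω) (q ω) ≤ ∑ ω, (p ω + q ω) :=
          Finset.sum_le_sum fun ω _ => max_le_add_of_nonneg (hp.1 ω) (hq.1 ω)
      _ = 2 := by rw [Finset.sum_add_distrib, hp.2, hq.2]; norm_num
  calc affinity p q ^ 2
      = (∑ ω, √(min (p ω) (q ω)) * √(max (p ω) (q ω))) ^ 2 := by
        simp only [affinity, ← Real.sqrt_mul (hmin _), min_mul_max]
    _ ≤ (√(∑ ω, min (p ω) (q ω)) * √(∑ ω, max (p ω) (q ω))) ^ 2 := by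
        gcongr
        exact Real.sum_sqrt_mul_sqrt_le _ hmin hmax
    _ = (∑ ω, min (p ω) (q ω)) * ∑ ω, max (p ω) (q ω) := by
        rw [mul_pow, Real.sq_sqrt (Finset.sum_nonneg fun ω _ => hmin ω),
          Real.sq_sqrt (Finset.sum_nonneg fun ω _ => hmax ω)]
    _ ≤ 2 * ∑ ω, min (p ω) (q ω) := by
        rw [mul_comm]
        gcongr
        exact Finset.sum_nonneg fun ω _ => hmin ω

end Affinity

section Assouad

variable {J : Type*} [DecidableEq J]

/-- The neighbour of a vertex of the cube that differs from it in the coordinate `j`. -/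
def flipAt (j : J) (u : J → Bool) : J → Bool := Function.update u j (!u j)

lemma flipAt_involutive (j : J) : Function.Involutive (flipAt j) := fun u => by simp [flipAt]

lemma flipAt_same (j : J) (u : J → Bool) : flipAt j u j = !u j := by simp [flipAt]

lemma flipAt_of_ne {i j : J} (hij : i ≠ j) (u : J → Bool) : flipAt j u i = u i :=
  Function.update_of_ne hij _ _

lemma sum_mul_flipAt_ge [Fintype J] {Ω : Type*} [Fintype Ω] {p : (J → Bool) → Ω → ℝ}
    {e : Ω → Bool → ℝ} (he : ∀ ω b, 0 ≤ e ω b) (he1 : ∀ ω b, e ω b + e ω (!b) = 1) {κ : ℝ} {j : J}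
    (hκ : ∀ u, κ ≤ ∑ ω, min (p u ω) (p (flipAt j u) ω)) :
    ∑ _u : J → Bool, κ / 2 ≤ ∑ u, ∑ ω, p u ω * e ω (u j) := by
  have hflip : ∑ u, ∑ ω, p u ω * e ω (u j) = ∑ u, ∑ ω, p (flipAt j u) ω * e ω (!u j) := by
    rw [← Equiv.sum_comp (flipAt_involutive j).toPerm]
    simp only [Function.Involutive.coe_toPerm, flipAt_same]
  have hpair : ∑ _u : J → Bool, κ ≤
      ∑ u, ∑ ω, (p u ω * e ω (u j) + p (flipAt j u) ω * e ω (!u j)) := by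
    refine Finset.sum_le_sum fun u _ => (hκ u).trans (Finset.sum_le_sum fun ω _ => ?_)
    calc min (p u ω) (p (flipAt j u) ω)
        = min (p u ω) (p (flipAt j u) ω) * e ω (u j) +
            min (p u ω) (p (flipAt j u) ω) * e ω (!u j) := by rw [← mul_add, he1, mul_one]
      _ ≤ _ := add_le_add (mul_le_mul_of_nonneg_right (min_le_left _ _) (he _ _))
          (mul_le_mul_of_nonneg_right (min_le_right _ _) (he _ _))
  simp only [Finset.sum_add_distrib, ← hflip] at hpair
  rw [← Finset.sum_div]
  linarith

lemma exists_assouad [Fintype J] {Ω : Type*} [Fintype Ω] {p : (J → Bool) → Ω → ℝ}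
    {e : J → Ω → Bool → ℝ} (he : ∀ j ω b, 0 ≤ e j ω b)
    (he1 : ∀ j ω b, e j ω b + e j ω (!b) = 1) {κ : ℝ}
    (hκ : ∀ j u, κ ≤ ∑ ω, min (p u ω) (p (flipAt j u) ω)) :
    ∃ u, Fintype.card J * (κ / 2) ≤ ∑ ω, p u ω * ∑ j, e j ω (u j) := by
  have hsum : ∑ _u : J → Bool, Fintype.card J * (κ / 2) ≤
      ∑ u, ∑ ω, p u ω * ∑ j, e j ω (u j) := by
    calc ∑ _u : J → Bool, Fintype.card J * (κ / 2)
        = ∑ _j : J, ∑ _u : J → Bool, κ / 2 := by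
          rw [Finset.sum_comm]
          simp only [Finset.sum_const, Finset.card_univ, nsmul_eq_mul]
      _ ≤ ∑ j, ∑ u, ∑ ω, p u ω * e j ω (u j) :=
          Finset.sum_le_sum fun j _ => sum_mul_flipAt_ge (he j) (he1 j) (hκ j)
      _ = ∑ u, ∑ ω, p u ω * ∑ j, e j ω (u j) := by
          rw [Finset.sum_comm]
          refine Finset.sum_congr rfl fun u _ => ?_
          rw [Finset.sum_comm]
          simp only [Finset.mul_sum]
  obtain ⟨u, -, hu⟩ := Finset.exists_le_of_sum_le Finset.univ_nonempty hsum
  exact ⟨u, hu⟩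

end Assouad

/-! ### Quadratic forms -/

section QuadraticForms

variable {d : ℕ}

lemma dotProduct_vecMulVec_self_mulVec (w v : Fin d → ℝ) :
    v ⬝ᵥ (Matrix.vecMulVec w w *ᵥ v) = (w ⬝ᵥ v) ^ 2 := by
  rw [Matrix.vecMulVec_mulVec, dotProduct_smul, dotProduct_comm v w, op_smul_eq_mul, sq]

lemma wnorm_inv_le {Z : Matrix (Fin d) (Fin d) ℝ} (hZ : IsUnit Z.det)
    {w : EuclideanSpace ℝ (Fin d)} {b : ℝ} (hb : 0 ≤ b)
    (hw : ∀ v, (w.ofLp ⬝ᵥ v) ^ 2 ≤ b ^ 2 * (v ⬝ᵥ (Z *ᵥ v))) : wnorm Z⁻¹ w ≤ b := by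
  have hinv : Z *ᵥ (Z⁻¹ *ᵥ w.ofLp) = w.ofLp := by
    rw [Matrix.mulVec_mulVec, Matrix.mul_nonsing_inv _ hZ, Matrix.one_mulVec]
  have hsq : (w.ofLp ⬝ᵥ (Z⁻¹ *ᵥ w.ofLp)) ^ 2 ≤ b ^ 2 * (w.ofLp ⬝ᵥ (Z⁻¹ *ᵥ w.ofLp)) := by
    simpa only [hinv, dotProduct_comm _ w.ofLp] using hw (Z⁻¹ *ᵥ w.ofLp)
  refine Real.sqrt_le_iff.2 ⟨hb, ?_⟩
  by_contra! hlt
  nlinarith [sq_nonneg b]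

end QuadraticForms

namespace MDP

variable {H : ℕ} {S A : Type} [Fintype S]

lemma PV_const (M : MDP H S A) (h : Fin H) (c : ℝ) (x : S) (a : A) :
    M.PV h (fun _ => c) x a = c := by
  rw [PV, ← Finset.sum_mul, (M.P_mem h x a).2, one_mul]

lemma truncVar_const (M : MDP H S A) (h : Fin H) (c : ℝ) (x : S) (a : A) :
    M.truncVar h (fun _ => c) x a = 1 := by
  rw [truncVar, condVar, PV_const, PV_const, sub_self, max_eq_left zero_le_one]

variable [Fintype A]

section Matrices

variable {d K : ℕ} (M : MDP H S A) (φ : S → A → EuclideanSpace ℝ (Fin d)) (h : Fin H)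

lemma dotProduct_Zstar_mulVec (lam : ℝ) (D : Dataset K H S A) (v : Fin d → ℝ) :
    v ⬝ᵥ (M.Zstar φ lam D h *ᵥ v) =
      ∑ τ, (M.truncVar h (M.optValue (h + 1)) (D τ h).1.1 (D τ h).1.2)⁻¹ *
        ((φ (D τ h).1.1 (D τ h).1.2).ofLp ⬝ᵥ v) ^ 2 + lam * (v ⬝ᵥ v) := by
  simp only [Zstar, Matrix.add_mulVec, dotProduct_add, Matrix.sum_mulVec, dotProduct_sum,
    Matrix.smul_mulVec, Matrix.one_mulVec, dotProduct_smul, smul_eq_mul,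
    dotProduct_vecMulVec_self_mulVec]

lemma Zstar_posDef {lam : ℝ} (hlam : 0 < lam) (D : Dataset K H S A) :
    (M.Zstar φ lam D h).PosDef := by
  refine Matrix.PosDef.posSemidef_add ?_ (Matrix.PosDef.one.smul hlam)
  refine Matrix.posSemidef_sum _ fun τ _ => Matrix.PosSemidef.smul ?_ ?_
  · simpa only [star_trivial] using
      Matrix.posSemidef_vecMulVec_self_star (φ (D τ h).1.1 (D τ h).1.2).ofLp
  · exact inv_nonneg.2 (zero_le_one.trans (le_max_left _ _))

lemma dotProduct_covMatrix_mulVec (ξ : S → ℝ) (π : Policy H S A) (v : Fin d → ℝ) :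
    v ⬝ᵥ (M.covMatrix φ ξ π h *ᵥ v) =
      M.expect ξ π h fun x a => ((φ x a).ofLp ⬝ᵥ v) ^ 2 := by
  have hsum : M.covMatrix φ ξ π h = ∑ s, M.pathProb ξ π s •
      Matrix.vecMulVec (φ (s h).1 (s h).2).ofLp (φ (s h).1 (s h).2).ofLp := by
    ext i j
    simp only [covMatrix, expect, Matrix.of_apply, Matrix.sum_apply, Matrix.smul_apply,
      Matrix.vecMulVec_apply, smul_eq_mul]
  simp only [hsum, expect, Matrix.sum_mulVec, dotProduct_sum, Matrix.smul_mulVec, dotProduct_smul,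
    smul_eq_mul, dotProduct_vecMulVec_self_mulVec]

lemma covMatrix_sub_smul_one_posSemidef {ξ : S → ℝ} {π : Policy H S A} {c : ℝ}
    (hc : ∀ v : Fin d → ℝ,
      c * (v ⬝ᵥ v) ≤ M.expect ξ π h fun x a => ((φ x a).ofLp ⬝ᵥ v) ^ 2) :
    (M.covMatrix φ ξ π h - c • (1 : Matrix (Fin d) (Fin d) ℝ)).PosSemidef := by
  refine Matrix.PosSemidef.of_dotProduct_mulVec_nonneg ?_ fun v => ?_
  · refine Matrix.IsHermitian.sub (Matrix.IsHermitian.ext fun i j => ?_)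
      (Matrix.isHermitian_one.smul (IsSelfAdjoint.all c))
    simp only [covMatrix, Matrix.of_apply, star_trivial, mul_comm (φ _ _ j)]
  · rw [star_trivial, Matrix.sub_mulVec, dotProduct_sub, dotProduct_covMatrix_mulVec,
      Matrix.smul_mulVec, Matrix.one_mulVec, dotProduct_smul, smul_eq_mul, sub_nonneg]
    exact hc v

end Matrices

/-! ### Optimal values when the maximal reward does not depend on the state -/

lemma value_of_lt (M : MDP H S A) (π : Policy H S A) (h : Fin H) (x : S) :
    M.value π h x = ∑ a, π.1 h x a * (M.r h x a + M.PV h (M.value π (h + 1)) x a) := by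
  rw [value, dif_pos h.2]
  rfl

lemma value_of_ge (M : MDP H S A) (π : Policy H S A) {h : ℕ} (hh : H ≤ h) (x : S) :
    M.value π h x = 0 := by
  rw [value, dif_neg hh.not_gt]

/-- The sum of the terms of index at least `h` of a sequence indexed by the steps. -/
def tailSum (b : Fin H → ℝ) (h : ℕ) : ℝ := ∑ k with h ≤ k.val, b k

lemma tailSum_zero (b : Fin H → ℝ) : tailSum b 0 = ∑ k, b k := by
  simp only [tailSum, Nat.zero_le, Finset.filter_true]

lemma tailSum_of_ge (b : Fin H → ℝ) {h : ℕ} (hh : H ≤ h) : tailSum b h = 0 :=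
  Finset.sum_eq_zero fun k hk => absurd (hh.trans (Finset.mem_filter.1 hk).2) k.2.not_ge

lemma tailSum_eq_add (b : Fin H → ℝ) (h : Fin H) :
    tailSum b h = b h + tailSum b (h + 1) := by
  rw [tailSum, tailSum, ← Finset.sum_insert (by simp)]
  congr 1
  grind

section StateIndependentReward

variable {M : MDP H S A} {b : Fin H → ℝ} {g : Fin H → A}

lemma value_le_tailSum (hb : ∀ h x a, M.r h x a ≤ b h) (π : Policy H S A) (h : ℕ) (x : S) :
    M.value π h x ≤ tailSum b h := by
  rcases le_total H h with hh | hh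
  · rw [value_of_ge M π hh, tailSum_of_ge b hh]
  induction hh using Nat.decreasingInduction generalizing x with
  | self => rw [value_of_ge M π le_rfl, tailSum_of_ge b le_rfl]
  | of_succ h hh ih =>
    calc M.value π h x
        = ∑ a, π.1 ⟨h, hh⟩ x a *
            (M.r ⟨h, hh⟩ x a + M.PV ⟨h, hh⟩ (M.value π (h + 1)) x a) := value_of_lt M π ⟨h, hh⟩ x
      _ ≤ ∑ a, π.1 ⟨h, hh⟩ x a * tailSum b h := by
          refine Finset.sum_le_sum fun a _ => mul_le_mul_of_nonneg_left ?_ ((π.2 _ x).1 a)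
          rw [tailSum_eq_add b ⟨h, hh⟩, ← PV_const M ⟨h, hh⟩ (tailSum b (h + 1)) x a]
          exact add_le_add (hb _ x a) (Finset.sum_le_sum fun x' _ =>
            mul_le_mul_of_nonneg_left (ih x') ((M.P_mem _ x a).1 x'))
      _ = tailSum b h := by rw [← Finset.sum_mul, (π.2 _ x).2, one_mul]

section OpenLoop

variable [DecidableEq A]

/-- The policy that plays the action `g h` in step `h`, in every state. -/
def openLoopPolicy (g : Fin H → A) : Policy H S A :=
  ⟨fun h _ => Pi.single (g h) 1, fun h _ => single_mem_stdSimplex ℝ (g h)⟩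

lemma value_openLoopPolicy (hg : ∀ h x, M.r h x (g h) = b h) (h : ℕ) (x : S) :
    M.value (openLoopPolicy g) h x = tailSum b h := by
  rcases le_total H h with hh | hh
  · rw [value_of_ge M _ hh, tailSum_of_ge b hh]
  induction hh using Nat.decreasingInduction generalizing x with
  | self => rw [value_of_ge M _ le_rfl, tailSum_of_ge b le_rfl]
  | of_succ h hh ih =>
    rw [value_of_lt M _ ⟨h, hh⟩ x, funext ih]
    simp [openLoopPolicy, Pi.single_apply, hg, PV_const, tailSum_eq_add b ⟨h, hh⟩]

lemma isOptimal_openLoopPolicy (hb : ∀ h x a, M.r h x a ≤ b h)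
    (hg : ∀ h x, M.r h x (g h) = b h) : M.IsOptimal (openLoopPolicy g) := fun h x π => by
  rw [value_openLoopPolicy hg]
  exact value_le_tailSum hb π h x

end OpenLoop

lemma optValue_eq_tailSum (hb : ∀ h x a, M.r h x a ≤ b h) (hg : ∀ h x, M.r h x (g h) = b h)
    (h : ℕ) : M.optValue h = fun _ => tailSum b h := by
  classical
  funext x
  have hle : ∀ π, M.value π h x ≤ tailSum b h := fun π => value_le_tailSum hb π h x
  refine le_antisymm (@ciSup_le _ _ _ ⟨openLoopPolicy g⟩ _ _ hle) ?_
  exact (value_openLoopPolicy hg h x).ge.trans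
    (le_ciSup ⟨_, Set.forall_mem_range.2 hle⟩ (openLoopPolicy g))

end StateIndependentReward

end MDP

/-! ### MDPs with independent, identically distributed states -/

namespace MDP

variable {H : ℕ} {S A : Type} [Fintype S]

/-- Every transition draws the next state from `ξ`, whatever the current state and action. -/
def HasIIDStates (M : MDP H S A) (ξ : S → ℝ) : Prop := ∀ h x a, M.P h x a = ξ

variable [Fintype A] {M : MDP H S A} {ξ : S → ℝ}

lemma pathProb_eq_productWeight (hM : M.HasIIDStates ξ) (π : Policy H S A) :
    M.pathProb ξ π = productWeight fun h => compWeight ξ (π.1 h) := by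
  funext s
  refine Finset.prod_congr rfl fun h _ => ?_
  split_ifs
  · rfl
  · simp only [hM _ _ _, compWeight]

lemma expect_eq_sum (hM : M.HasIIDStates ξ) (hξ : ξ ∈ stdSimplex ℝ S) (π : Policy H S A)
    (h : Fin H) (f : S → A → ℝ) :
    M.expect ξ π h f = ∑ x, ξ x * ∑ a, π.1 h x a * f x a := by
  rw [expect, pathProb_eq_productWeight hM, ← sum_compWeight_mul ξ (π.1 h) fun z => f z.1 z.2]
  exact sum_productWeight_mul_apply
    (fun k => (compWeight_mem_stdSimplex hξ (π.2 k)).2) (fun z => f z.1 z.2) h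

lemma expect_le (hM : M.HasIIDStates ξ) (hξ : ξ ∈ stdSimplex ℝ S) (π : Policy H S A)
    (h : Fin H) {f : S → A → ℝ} {c : ℝ} (hf : ∀ x a, f x a ≤ c) : M.expect ξ π h f ≤ c := by
  rw [expect, pathProb_eq_productWeight hM]
  have hp := productWeight_mem_stdSimplex fun k => compWeight_mem_stdSimplex hξ (π.2 k)
  calc _ ≤ ∑ s, productWeight (fun k => compWeight ξ (π.1 k)) s * c :=
        Finset.sum_le_sum fun s _ => mul_le_mul_of_nonneg_left (hf _ _) (hp.1 s)
    _ = c := by rw [← Finset.sum_mul, hp.2, one_mul]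

lemma sum_mul_value_eq_tailSum (hM : M.HasIIDStates ξ) (hξ : ∑ x, ξ x = 1) (π : Policy H S A)
    (h : ℕ) :
    ∑ x, ξ x * M.value π h x = tailSum (fun k => ∑ x, ξ x * ∑ a, π.1 k x a * M.r k x a) h := by
  rcases le_total H h with hh | hh
  · simp only [value_of_ge M π hh, mul_zero, Finset.sum_const_zero, tailSum_of_ge _ hh]
  induction hh using Nat.decreasingInduction with
  | self =>
    simp only [value_of_ge M π le_rfl, mul_zero, Finset.sum_const_zero, tailSum_of_ge _ le_rfl]
  | of_succ h hh ih =>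
    have hnext : ∀ x a, M.PV ⟨h, hh⟩ (M.value π (h + 1)) x a =
        ∑ x', ξ x' * M.value π (h + 1) x' := fun x a => by rw [PV, hM]
    rw [tailSum_eq_add _ ⟨h, hh⟩, ← ih]
    simp only [value_of_lt M π ⟨h, hh⟩, hnext, mul_add, Finset.sum_add_distrib, ← Finset.sum_mul,
      (π.2 _ _).2, hξ, one_mul]

lemma sum_mul_suboptimality (hM : M.HasIIDStates ξ) (hξ : ∑ x, ξ x = 1) {b : Fin H → ℝ}
    {g : Fin H → A} (hb : ∀ h x a, M.r h x a ≤ b h) (hg : ∀ h x, M.r h x (g h) = b h)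
    (π : Policy H S A) :
    ∑ x, ξ x * (M.optValue 0 x - M.value π 0 x) =
      ∑ h, ∑ x, ξ x * ∑ a, π.1 h x a * (b h - M.r h x a) := by
  simp only [mul_sub, Finset.sum_sub_distrib, sum_mul_value_eq_tailSum hM hξ,
    optValue_eq_tailSum hb hg, tailSum_zero, ← Finset.sum_mul, (π.2 _ _).2, hξ, one_mul]

section DataLaw

variable {Y : Type*}

/-- The weight of a step's outcome `((x, a), y)` under the behavior policy `β`: states are drawn
from `ξ`, and `κ h (x, a)` are the weights of the reward labels `y`. -/
def stepWeight (ξ : S → ℝ) (β : Policy H S A) (κ : Fin H → S × A → Y → ℝ) (h : Fin H) :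
    (S × A) × Y → ℝ :=
  compWeight (compWeight ξ (β.1 h)) (κ h)

/-- The weight of the outcomes of `K` independent trajectories. -/
def dataWeight (K : ℕ) (ξ : S → ℝ) (β : Policy H S A) (κ : Fin H → S × A → Y → ℝ) :
    (Fin K → Fin H → (S × A) × Y) → ℝ :=
  productWeight fun _ => productWeight (stepWeight ξ β κ)

/-- The dataset whose outcomes are `ω`, when the label `y` stands for the reward `g y`. -/
def toDataset {K : ℕ} (g : Y → ℝ) (ω : Fin K → Fin H → (S × A) × Y) : Dataset K H S A :=
  fun τ h => ((ω τ h).1, g (ω τ h).2)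

variable [Fintype Y] {β : Policy H S A} {κ : Fin H → S × A → Y → ℝ} {K : ℕ}

lemma stepWeight_mem_stdSimplex (hξ : ξ ∈ stdSimplex ℝ S) (hκ : ∀ h z, κ h z ∈ stdSimplex ℝ Y)
    (h : Fin H) : stepWeight ξ β κ h ∈ stdSimplex ℝ ((S × A) × Y) :=
  compWeight_mem_stdSimplex (compWeight_mem_stdSimplex hξ (β.2 h)) (hκ h)

lemma dataWeight_mem_stdSimplex (hξ : ξ ∈ stdSimplex ℝ S)
    (hκ : ∀ h z, κ h z ∈ stdSimplex ℝ Y) :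
    dataWeight K ξ β κ ∈ stdSimplex ℝ (Fin K → Fin H → (S × A) × Y) :=
  productWeight_mem_stdSimplex fun _ =>
    productWeight_mem_stdSimplex (stepWeight_mem_stdSimplex hξ hκ)

variable [MeasurableSpace S] [MeasurableSpace A] {g : Y → ℝ}

lemma trajLaw_eq_weightedDirac (hM : M.HasIIDStates ξ) (hξ : ξ ∈ stdSimplex ℝ S)
    (hκ : ∀ h z, κ h z ∈ stdSimplex ℝ Y) (hR : ∀ h x a, M.R h x a = weightedDirac (κ h (x, a)) g) :
    M.trajLaw ξ β = weightedDirac (productWeight (stepWeight ξ β κ))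
      fun s h => ((s h).1, g (s h).2) := by
  have hpath : ∀ h, compWeight ξ (β.1 h) ∈ stdSimplex ℝ (S × A) := fun h =>
    compWeight_mem_stdSimplex hξ (β.2 h)
  refine Eq.trans ?_ (pi_weightedDirac (p := stepWeight ξ β κ)
    (fun h => (stepWeight_mem_stdSimplex hξ hκ h).1) fun _ y => (y.1, g y.2))
  simp only [stepWeight, weightedDirac_compWeight (hpath _).1,
    pi_sum_smul fun _ _ => ENNReal.ofReal_ne_top, trajLaw, pathProb_eq_productWeight hM,
    productWeight, ENNReal.ofReal_prod_of_nonneg fun h _ => (hpath h).1 _, hR]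

lemma dataLaw_eq_weightedDirac (hM : M.HasIIDStates ξ) (hξ : ξ ∈ stdSimplex ℝ S)
    (hκ : ∀ h z, κ h z ∈ stdSimplex ℝ Y) (hR : ∀ h x a, M.R h x a = weightedDirac (κ h (x, a)) g) :
    M.dataLaw K ξ β = weightedDirac (dataWeight K ξ β κ) (toDataset g) := by
  rw [dataLaw, trajLaw_eq_weightedDirac hM hξ hκ hR]
  exact pi_weightedDirac
    (fun _ => (productWeight_mem_stdSimplex (stepWeight_mem_stdSimplex hξ hκ)).1) _

lemma expSubopt_eq_sum [MeasurableSingletonClass S] [MeasurableSingletonClass A]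
    (hM : M.HasIIDStates ξ) (hξ : ξ ∈ stdSimplex ℝ S)
    (hκ : ∀ h z, κ h z ∈ stdSimplex ℝ Y) (hR : ∀ h x a, M.R h x a = weightedDirac (κ h (x, a)) g)
    (alg : Dataset K H S A → Policy H S A) :
    M.expSubopt ξ β alg = ∑ ω, dataWeight K ξ β κ ω *
      ∑ x, ξ x * (M.optValue 0 x - M.value (alg (toDataset g ω)) 0 x) := by
  rw [expSubopt, dataLaw_eq_weightedDirac hM hξ hκ hR]
  exact integral_weightedDirac (dataWeight_mem_stdSimplex hξ hκ).1 _ _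

end DataLaw

end MDP

/-! ### The hard instances -/

section Probe

variable {n : ℕ}

/-- The actions of the behavior policy: the origin and the unit vectors of the cube. -/
def probe (o : Option (Fin n)) : Fin n → Bool := fun i => decide (o = some i)

/-- The probabilities with which the behavior policy plays the actions `probe o`. -/
def probeWeight (n : ℕ) (o : Option (Fin n)) : ℝ := o.elim (1 / 2) fun _ => 1 / (2 * n)

/-- The action distribution of the behavior policy. -/
def probeDist (n : ℕ) (a : Fin n → Bool) : ℝ :=
  ∑ o, probeWeight n o * if a = probe o then 1 else 0

lemma probe_injective : Function.Injective (probe (n := n)) := fun o o' h =>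
  Option.ext fun i => by simpa [probe] using congrFun h i

lemma sum_probeWeight_mul (f : Option (Fin n) → ℝ) :
    ∑ o, probeWeight n o * f o = f none / 2 + (∑ i, f (some i)) / (2 * n) := by
  rw [Fintype.sum_option]
  simp only [probeWeight, Option.elim, ← Finset.mul_sum]
  ring

lemma sum_probeDist_mul (f : (Fin n → Bool) → ℝ) :
    ∑ a, probeDist n a * f a = ∑ o, probeWeight n o * f (probe o) := by
  simp only [probeDist, Finset.sum_mul, mul_assoc]
  rw [Finset.sum_comm]
  simp

lemma probeWeight_nonneg (o : Option (Fin n)) : 0 ≤ probeWeight n o := by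
  cases o <;> simp [probeWeight]

lemma probeDist_mem_stdSimplex [NeZero n] : probeDist n ∈ stdSimplex ℝ (Fin n → Bool) := by
  refine ⟨fun a => Finset.sum_nonneg fun o _ =>
    mul_nonneg (probeWeight_nonneg o) (by split_ifs <;> simp), ?_⟩
  have h := (sum_probeDist_mul (n := n) fun _ => 1).trans (sum_probeWeight_mul fun _ => 1)
  have hn : (n : ℝ) ≠ 0 := NeZero.ne _
  simp only [mul_one, Finset.sum_const, Finset.card_univ, Fintype.card_fin, nsmul_eq_mul] at h
  rw [h]
  field_simp
  norm_num

/-- The behavior policy: it draws a probing action, regardless of step and state. -/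
def behavior (n H : ℕ) [NeZero n] (S : Type) : Policy H S (Fin n → Bool) :=
  ⟨fun _ _ => probeDist n, fun _ _ => probeDist_mem_stdSimplex⟩

end Probe

/-- The value of a Bernoulli reward. -/
def bit (b : Bool) : ℝ := if b then 1 else 0

/-- The probabilities of a Bernoulli distribution. -/
def bernWeight (p : ℝ) (b : Bool) : ℝ := if b then p else 1 - p

lemma bernWeight_mem_stdSimplex {p : ℝ} (hp : p ∈ Set.Icc (0 : ℝ) 1) :
    bernWeight p ∈ stdSimplex ℝ Bool :=
  ⟨fun b => by cases b <;> simp [bernWeight, hp.1, hp.2], by simp [bernWeight]⟩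

/-- The Bernoulli distribution on `{0, 1}`. -/
def bernLaw (p : ℝ) : Measure ℝ := weightedDirac (bernWeight p) bit

lemma integral_bernLaw {p : ℝ} (hp : p ∈ Set.Icc (0 : ℝ) 1) : ∫ y, y ∂(bernLaw p) = p := by
  rw [bernLaw, integral_weightedDirac (bernWeight_mem_stdSimplex hp).1 bit fun y => y]
  simp [bernWeight, bit]

lemma ae_bernLaw (p : ℝ) : ∀ᵐ y ∂(bernLaw p), y ∈ Set.Icc (0 : ℝ) 1 := by
  rw [bernLaw, weightedDirac, ae_iff, Measure.finsetSum_apply]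
  refine Finset.sum_eq_zero fun b _ => ?_
  cases b <;> simp [bit]

section MeanReward

variable {n : ℕ}

/-- Mean reward of the action `a` when the optimal action is `v`. -/
def meanReward (ε : ℝ) (v a : Fin n → Bool) : ℝ :=
  1 / 2 + ε * ∑ i, if a i then (if v i then 1 else -1) else 0

/-- The maximal mean reward when the optimal action is `v`. -/
def bestReward (ε : ℝ) (v : Fin n → Bool) : ℝ := 1 / 2 + ε * ∑ i, bit (v i)

lemma bestReward_sub_meanReward (ε : ℝ) (v a : Fin n → Bool) :
    bestReward ε v - meanReward ε v a = ε * ∑ i, if a i = v i then 0 else 1 := by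
  rw [bestReward, meanReward, add_sub_add_left_eq_sub, ← mul_sub, ← Finset.sum_sub_distrib]
  congr! 2 with i
  cases a i <;> cases v i <;> simp [bit]

lemma meanReward_le_bestReward {ε : ℝ} (hε : 0 ≤ ε) (v a : Fin n → Bool) :
    meanReward ε v a ≤ bestReward ε v := by
  rw [← sub_nonneg, bestReward_sub_meanReward]
  exact mul_nonneg hε (Finset.sum_nonneg fun i _ => by split_ifs <;> simp)

lemma meanReward_self (ε : ℝ) (v : Fin n → Bool) : meanReward ε v v = bestReward ε v :=
  (sub_eq_zero.1 (by simp [bestReward_sub_meanReward])).symm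

lemma meanReward_mem_Icc [NeZero n] {ε : ℝ} (hε : ε ∈ Set.Icc 0 (1 / (2 * n : ℝ)))
    (v a : Fin n → Bool) : meanReward ε v a ∈ Set.Icc (0 : ℝ) 1 := by
  have hsum : |∑ i, (if a i then (if v i then 1 else -1) else 0 : ℝ)| ≤ n :=
    calc _ ≤ ∑ i, |(if a i then (if v i then 1 else -1) else 0 : ℝ)| :=
          Finset.abs_sum_le_sum_abs _ _
      _ ≤ ∑ _i : Fin n, (1 : ℝ) := Finset.sum_le_sum fun i _ => by split_ifs <;> simp
      _ = n := by simp
  have hεn : ε * n ≤ 1 / 2 := by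
    have hn : (n : ℝ) ≠ 0 := NeZero.ne _
    calc ε * n ≤ 1 / (2 * n) * n := by gcongr; exact hε.2
      _ = 1 / 2 := by field_simp
  have hdev := (abs_mul ε _).trans_le
    ((mul_le_mul_of_nonneg_left hsum (abs_nonneg ε)).trans_eq (by rw [abs_of_nonneg hε.1]))
  rw [abs_le] at hdev
  rw [meanReward]
  constructor <;> linarith [hdev.1, hdev.2]

end MeanReward

section Feature

variable {n : ℕ}

/-- The feature vector of the action `a`, of norm at most `1`. -/
def feature (a : Fin n → Bool) : EuclideanSpace ℝ (Fin (n + 1)) :=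
  WithLp.toLp 2 (Fin.cons (1 / √2) fun i => bit (a i) / √(2 * n))

lemma feature_dotProduct (a : Fin n → Bool) (v : Fin (n + 1) → ℝ) :
    (feature a).ofLp ⬝ᵥ v = v 0 / √2 + ∑ i, bit (a i) * (v i.succ / √(2 * n)) := by
  simp only [feature, dotProduct, Fin.sum_univ_succ, Fin.cons_zero, Fin.cons_succ]
  congr 1
  · ring
  · exact Finset.sum_congr rfl fun i _ => by ring

lemma inner_feature (a : Fin n → Bool) (w : EuclideanSpace ℝ (Fin (n + 1))) :
    inner ℝ (feature a) w = w 0 / √2 + ∑ i, bit (a i) * (w i.succ / √(2 * n)) := by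
  rw [EuclideanSpace.inner_eq_star_dotProduct, star_trivial, dotProduct_comm, feature_dotProduct]

lemma norm_toLp_cons_le {y b c : ℝ} {z : Fin n → ℝ} (hc : 0 ≤ c) (hy : y ^ 2 ≤ c ^ 2 - n * b)
    (hz : ∀ i, z i ^ 2 ≤ b) :
    ‖(WithLp.toLp 2 (Fin.cons y z) : EuclideanSpace ℝ (Fin (n + 1)))‖ ≤ c := by
  rw [EuclideanSpace.norm_eq, Real.sqrt_le_left hc, Fin.sum_univ_succ]
  have := Finset.sum_le_sum fun i (_ : i ∈ Finset.univ) => hz i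
  simp only [Finset.sum_const, Finset.card_univ, Fintype.card_fin, nsmul_eq_mul] at this
  simp only [Fin.cons_zero, Fin.cons_succ, Real.norm_eq_abs, sq_abs]
  linarith

lemma norm_feature_le_one [NeZero n] (a : Fin n → Bool) : ‖feature a‖ ≤ 1 := by
  have hn : (n : ℝ) ≠ 0 := NeZero.ne _
  refine norm_toLp_cons_le (b := 1 / (2 * n)) zero_le_one ?_ fun i => ?_
  · rw [div_pow, Real.sq_sqrt two_pos.le]
    field_simp
    norm_num
  · rw [div_pow, Real.sq_sqrt (by positivity)]
    gcongr
    cases a i <;> simp [bit]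

end Feature

section HardMDP

variable {n H : ℕ} [NeZero n] {S : Type} [Fintype S] {ξ : S → ℝ} {ε : ℝ}

/-- The hard instance with parameter `u`: the states are drawn independently from `ξ`, and the
reward of step `h` is Bernoulli with optimal action `fun i => u (h, i)`. -/
def hardMDP (hξ : ξ ∈ stdSimplex ℝ S) (hε : ε ∈ Set.Icc 0 (1 / (2 * n : ℝ)))
    (u : Fin H × Fin n → Bool) : MDP H S (Fin n → Bool) where
  P _ _ _ := ξ
  P_mem _ _ _ := hξ
  R h _ a := bernLaw (meanReward ε (fun i => u (h, i)) a)
  R_prob _ _ _ :=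
    isProbabilityMeasure_weightedDirac (bernWeight_mem_stdSimplex (meanReward_mem_Icc hε _ _)) _
  R_mem _ _ _ := ae_bernLaw _

variable (hξ : ξ ∈ stdSimplex ℝ S) (hε : ε ∈ Set.Icc 0 (1 / (2 * n : ℝ)))
  (u : Fin H × Fin n → Bool)

lemma hardMDP_hasIIDStates : (hardMDP hξ hε u).HasIIDStates ξ := fun _ _ _ => rfl

lemma hardMDP_r (h : Fin H) (x : S) (a : Fin n → Bool) :
    (hardMDP hξ hε u).r h x a = meanReward ε (fun i => u (h, i)) a :=
  integral_bernLaw (meanReward_mem_Icc hε _ _)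

lemma hardMDP_r_le (h : Fin H) (x : S) (a : Fin n → Bool) :
    (hardMDP hξ hε u).r h x a ≤ bestReward ε fun i => u (h, i) :=
  (hardMDP_r hξ hε u h x a).trans_le (meanReward_le_bestReward hε.1 _ _)

lemma hardMDP_r_self (h : Fin H) (x : S) :
    (hardMDP hξ hε u).r h x (fun i => u (h, i)) = bestReward ε fun i => u (h, i) :=
  (hardMDP_r hξ hε u h x _).trans (meanReward_self _ _)

lemma exists_isOptimal_hardMDP : ∃ π, (hardMDP hξ hε u).IsOptimal π :=
  ⟨_, MDP.isOptimal_openLoopPolicy (hardMDP_r_le hξ hε u) (hardMDP_r_self hξ hε u)⟩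

lemma isLinear_hardMDP : (hardMDP hξ hε u).IsLinear fun _ => feature := by
  have hn : (1 : ℝ) ≤ n := by exact_mod_cast NeZero.one_le
  have h2n : 0 < √(2 * n : ℝ) := by positivity
  refine ⟨fun _ => norm_feature_le_one, fun h =>
    ⟨fun x' => ξ x' • WithLp.toLp 2 (Fin.cons √2 fun _ => 0),
      WithLp.toLp 2 (Fin.cons (√2 / 2) fun i => √(2 * n) * (ε * if u (h, i) then 1 else -1)),
      fun x a x' => ?_, fun x a => ?_, ?_, ?_⟩⟩
  · rw [inner_smul_right, inner_feature]
    simp [hardMDP]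
  · rw [inner_feature, hardMDP_r, meanReward, Finset.mul_sum]
    simp only [Fin.cons_zero, Fin.cons_succ]
    congr 1
    · rw [div_right_comm, div_self (by positivity)]
    · refine Finset.sum_congr rfl fun i _ => ?_
      rw [mul_div_cancel_left₀ _ h2n.ne']
      cases a i <;> simp [bit]
  · rw [← Finset.sum_smul, hξ.2, one_smul]
    refine norm_toLp_cons_le (b := 0) (Real.sqrt_nonneg _) ?_ fun _ => by simp
    rw [Real.sq_sqrt two_pos.le, Real.sq_sqrt (Nat.cast_nonneg _)]
    push_cast
    linarith
  · have hεn : n * (2 * n * ε ^ 2) ≤ 1 / 2 := by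
      have hε' : n * ε ≤ 1 / 2 := by
        calc n * ε ≤ n * (1 / (2 * n)) := by gcongr; exact hε.2
          _ = 1 / 2 := by field_simp
      nlinarith [mul_nonneg (zero_le_one.trans hn) hε.1]
    refine norm_toLp_cons_le (b := 2 * n * ε ^ 2) (Real.sqrt_nonneg _) ?_ fun i => ?_
    · rw [div_pow, Real.sq_sqrt two_pos.le, Real.sq_sqrt (Nat.cast_nonneg _)]
      push_cast
      linarith
    · rw [mul_pow, Real.sq_sqrt (by positivity)]
      split_ifs <;> simp

end HardMDP

/-! ### Coverage by the behavior policy -/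

section ProbeEnergy

variable {n : ℕ}

/-- The quadratic form of the features under the behavior policy. -/
def probeEnergy (v : Fin (n + 1) → ℝ) : ℝ :=
  ∑ o, probeWeight n o * ((feature (probe o)).ofLp ⬝ᵥ v) ^ 2

/-- The affine coordinates of an action with respect to the probing actions. -/
def probeCoord (a : Fin n → Bool) (o : Option (Fin n)) : ℝ :=
  o.elim (1 - ∑ i, bit (a i)) fun i => bit (a i)

lemma feature_probe_none_dotProduct (v : Fin (n + 1) → ℝ) :
    (feature (probe none)).ofLp ⬝ᵥ v = v 0 / √2 := by
  simp [feature_dotProduct, probe, bit]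

lemma feature_probe_some_dotProduct (j : Fin n) (v : Fin (n + 1) → ℝ) :
    (feature (probe (some j))).ofLp ⬝ᵥ v = v 0 / √2 + v j.succ / √(2 * n) := by
  simp [feature_dotProduct, probe, bit]

lemma feature_dotProduct_eq_sum_probe (a : Fin n → Bool) (v : Fin (n + 1) → ℝ) :
    (feature a).ofLp ⬝ᵥ v = ∑ o, probeCoord a o * ((feature (probe o)).ofLp ⬝ᵥ v) := by
  simp only [Fintype.sum_option, probeCoord, Option.elim, feature_probe_none_dotProduct,
    feature_probe_some_dotProduct, feature_dotProduct a, mul_add, Finset.sum_add_distrib,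
    ← Finset.sum_mul]
  ring

variable [NeZero n]

lemma probeWeight_pos (o : Option (Fin n)) : 0 < probeWeight n o := by
  have hn : 0 < (n : ℝ) := by exact_mod_cast NeZero.pos n
  cases o <;> simp [probeWeight, hn]

lemma sum_sq_probeCoord_div_le (a : Fin n → Bool) :
    ∑ o, probeCoord a o ^ 2 / probeWeight n o ≤ 4 * n ^ 2 := by
  have hn : (1 : ℝ) ≤ n := by exact_mod_cast NeZero.one_le
  have hbit : ∀ i, bit (a i) ∈ Set.Icc 0 1 ∧ bit (a i) ^ 2 = bit (a i) := fun i => by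
    cases a i <;> simp [bit]
  have hs0 : 0 ≤ ∑ i, bit (a i) := Finset.sum_nonneg fun i _ => (hbit i).1.1
  have hsn : ∑ i, bit (a i) ≤ n := by
    simpa using Finset.sum_le_sum fun i (_ : i ∈ Finset.univ) => (hbit i).1.2
  calc ∑ o, probeCoord a o ^ 2 / probeWeight n o
      = 2 * (1 - ∑ i, bit (a i)) ^ 2 + 2 * n * ∑ i, bit (a i) := by
        simp only [Fintype.sum_option, probeCoord, probeWeight, Option.elim, (hbit _).2,
          Finset.mul_sum]
        congr 1
        · ring
        · exact Finset.sum_congr rfl fun i _ => by rw [div_div_eq_mul_div, div_one, mul_comm]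
    _ ≤ 4 * n ^ 2 := by nlinarith

lemma sq_feature_dotProduct_le (a : Fin n → Bool) (v : Fin (n + 1) → ℝ) :
    ((feature a).ofLp ⬝ᵥ v) ^ 2 ≤ 4 * n ^ 2 * probeEnergy v := by
  have hQ : 0 ≤ probeEnergy v :=
    Finset.sum_nonneg fun o _ => mul_nonneg (probeWeight_nonneg o) (sq_nonneg _)
  refine le_trans ?_ (mul_le_mul_of_nonneg_right (sum_sq_probeCoord_div_le a) hQ)
  rw [feature_dotProduct_eq_sum_probe]
  refine Finset.sum_sq_le_sum_mul_sum_of_sq_le_mul _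
    (fun o _ => div_nonneg (sq_nonneg _) (probeWeight_nonneg o))
    (fun o _ => mul_nonneg (probeWeight_nonneg o) (sq_nonneg _)) fun o _ => ?_
  have := (probeWeight_pos o).ne'
  refine le_of_eq ?_
  field_simp

lemma sq_succ_le (v : Fin (n + 1) → ℝ) (j : Fin n) :
    v j.succ ^ 2 ≤ 4 * n * (((feature (probe (some j))).ofLp ⬝ᵥ v) ^ 2 +
      ((feature (probe none)).ofLp ⬝ᵥ v) ^ 2) := by
  have hn : 0 < (n : ℝ) := by exact_mod_cast NeZero.pos n
  rw [feature_probe_none_dotProduct, feature_probe_some_dotProduct]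
  have hv : v j.succ ^ 2 = 2 * n * (v j.succ / √(2 * n)) ^ 2 := by
    rw [div_pow, Real.sq_sqrt (by positivity)]
    field_simp
  rw [hv]
  nlinarith [mul_nonneg hn.le (sq_nonneg (2 * (v 0 / √2) + v j.succ / √(2 * n)))]

lemma dotProduct_self_le_probeEnergy (v : Fin (n + 1) → ℝ) :
    v ⬝ᵥ v ≤ 12 * n ^ 2 * probeEnergy v := by
  have hn : (1 : ℝ) ≤ n := by exact_mod_cast NeZero.one_le
  rw [probeEnergy, sum_probeWeight_mul fun o => ((feature (probe o)).ofLp ⬝ᵥ v) ^ 2]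
  have hv0 : v 0 ^ 2 = 2 * ((feature (probe none)).ofLp ⬝ᵥ v) ^ 2 := by
    rw [feature_probe_none_dotProduct, div_pow, Real.sq_sqrt two_pos.le]
    ring
  have hvj := Finset.sum_le_sum fun j (_ : j ∈ Finset.univ) => sq_succ_le v j
  simp only [← Finset.mul_sum, Finset.sum_add_distrib, Finset.sum_const, Finset.card_univ,
    Fintype.card_fin, nsmul_eq_mul] at hvj
  generalize (feature (probe none)).ofLp ⬝ᵥ v = y at *
  generalize hT : ∑ j : Fin n, ((feature (probe (some j))).ofLp ⬝ᵥ v) ^ 2 = T at *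
  have hT0 : 0 ≤ T := hT ▸ Finset.sum_nonneg fun j _ => sq_nonneg _
  calc v ⬝ᵥ v = v 0 ^ 2 + ∑ j : Fin n, v j.succ ^ 2 := by
        simp only [dotProduct, Fin.sum_univ_succ, sq]
    _ ≤ 2 * y ^ 2 + 4 * n * (T + n * y ^ 2) := by rw [hv0]; gcongr
    _ ≤ 6 * n ^ 2 * y ^ 2 + 6 * n * T := by
        nlinarith [mul_nonneg (sub_nonneg.2 (one_le_pow₀ hn : 1 ≤ (n : ℝ) ^ 2)) (sq_nonneg y),
          mul_nonneg (zero_le_one.trans hn) hT0]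
    _ = 12 * n ^ 2 * (y ^ 2 / 2 + T / (2 * n)) := by field_simp; ring

end ProbeEnergy

section Coverage

variable {n H K : ℕ} {S : Type}

/-- A dataset that visits every probing action at least half as often as expected. -/
def IsCovered (D : Dataset K H S (Fin n → Bool)) : Prop :=
  ∀ h o, K * probeWeight n o / 2 ≤ Finset.card {τ | (D τ h).1.2 = probe o}

lemma IsCovered.mul_probeEnergy_le {D : Dataset K H S (Fin n → Bool)} (hD : IsCovered D)
    (h : Fin H) (v : Fin (n + 1) → ℝ) :
    K / 2 * probeEnergy v ≤ ∑ τ, ((feature (D τ h).1.2).ofLp ⬝ᵥ v) ^ 2 := by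
  refine le_trans ?_ (sum_card_fiber_mul_le (fun τ => (D τ h).1.2) probe_injective
    (f := fun a => ((feature a).ofLp ⬝ᵥ v) ^ 2) fun a => sq_nonneg _)
  rw [probeEnergy, Finset.mul_sum]
  refine Finset.sum_le_sum fun o _ => ?_
  rw [← mul_assoc, ← mul_div_right_comm]
  exact mul_le_mul_of_nonneg_right (hD h o) (sq_nonneg _)

variable [NeZero n] [Fintype S] {ξ : S → ℝ} {ε : ℝ}
  (hξ : ξ ∈ stdSimplex ℝ S) (hε : ε ∈ Set.Icc 0 (1 / (2 * n : ℝ))) (u : Fin H × Fin n → Bool)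

lemma covMatrix_hardMDP_sub_smul_one_posSemidef (h : Fin H) :
    ((hardMDP hξ hε u).covMatrix (fun _ => feature) ξ (behavior n H S) h -
      (1 / 12 / (n + 1 : ℕ) ^ 2 : ℝ) • (1 : Matrix _ _ ℝ)).PosSemidef := by
  have hn : (0 : ℝ) < n := by exact_mod_cast NeZero.pos n
  refine MDP.covMatrix_sub_smul_one_posSemidef _ _ _ fun v => ?_
  have henergy : (hardMDP hξ hε u).expect ξ (behavior n H S) h
      (fun _ a => ((feature a).ofLp ⬝ᵥ v) ^ 2) = probeEnergy v := by
    rw [MDP.expect_eq_sum (hardMDP_hasIIDStates hξ hε u) hξ]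
    simp only [behavior, sum_probeDist_mul fun a => ((feature a).ofLp ⬝ᵥ v) ^ 2,
      ← Finset.sum_mul, hξ.2, one_mul, probeEnergy]
  rw [henergy]
  calc (1 / 12 / (n + 1 : ℕ) ^ 2 : ℝ) * (v ⬝ᵥ v)
      ≤ 1 / 12 / (n : ℝ) ^ 2 * (12 * n ^ 2 * probeEnergy v) := by
        gcongr
        · exact Finset.sum_nonneg fun i _ => mul_self_nonneg _
        · exact n.le_succ
        · exact dotProduct_self_le_probeEnergy v
    _ = probeEnergy v := by field_simp

variable {D : Dataset K H S (Fin n → Bool)}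

lemma dotProduct_Zstar_hardMDP_mulVec (lam : ℝ) (h : Fin H) (v : Fin (n + 1) → ℝ) :
    v ⬝ᵥ ((hardMDP hξ hε u).Zstar (fun _ => feature) lam D h *ᵥ v) =
      ∑ τ, ((feature (D τ h).1.2).ofLp ⬝ᵥ v) ^ 2 + lam * (v ⬝ᵥ v) := by
  simp only [MDP.dotProduct_Zstar_mulVec, MDP.truncVar_const, inv_one, one_mul,
    MDP.optValue_eq_tailSum (hardMDP_r_le hξ hε u) (hardMDP_r_self hξ hε u)]

lemma IsCovered.wnorm_Zstar_inv_le (hD : IsCovered D) (hK : 0 < K) {lam : ℝ} (hlam : 0 < lam)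
    (h : Fin H) (a : Fin n → Bool) :
    wnorm ((hardMDP hξ hε u).Zstar (fun _ => feature) lam D h)⁻¹ (feature a) ≤
      √(8 * n ^ 2 / K) := by
  refine wnorm_inv_le (MDP.Zstar_posDef _ _ h hlam D).det_pos.ne'.isUnit (Real.sqrt_nonneg _)
    fun v => ?_
  have hv : 0 ≤ lam * (v ⬝ᵥ v) :=
    mul_nonneg hlam.le (Finset.sum_nonneg fun i _ => mul_self_nonneg _)
  rw [dotProduct_Zstar_hardMDP_mulVec, Real.sq_sqrt (by positivity)]
  calc _ ≤ 4 * n ^ 2 * probeEnergy v := sq_feature_dotProduct_le a v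
    _ = 8 * n ^ 2 / K * (K / 2 * probeEnergy v) := by
        have : (K : ℝ) ≠ 0 := Nat.cast_ne_zero.2 hK.ne'
        field_simp
        ring
    _ ≤ _ := by
        gcongr
        linarith [hD.mul_probeEnergy_le h v]

end Coverage

/-! ### Indistinguishability of neighbouring instances -/

lemma one_sub_le_affinity_bernWeight {x : ℝ} (hx : x ^ 2 ≤ 1 / 4) :
    1 - 4 * x ^ 2 ≤ affinity (bernWeight (1 / 2 + x)) (bernWeight (1 / 2 - x)) :=
  calc 1 - 4 * x ^ 2 ≤ √(1 - 4 * x ^ 2) :=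
        Real.le_sqrt_of_sq_le (by nlinarith [mul_nonneg (sub_nonneg.2 hx) (sq_nonneg x)])
    _ = √(2 ^ 2 * ((1 / 2 + x) * (1 / 2 - x))) := by ring_nf
    _ = 2 * √((1 / 2 + x) * (1 / 2 - x)) := by
        rw [Real.sqrt_mul (by norm_num), Real.sqrt_sq two_pos.le]
    _ = affinity (bernWeight (1 / 2 + x)) (bernWeight (1 / 2 - x)) := by
        simp only [affinity, bernWeight, Fintype.sum_bool, Bool.false_eq_true, if_true, if_false]
        ring_nf

lemma meanReward_probe {n : ℕ} (ε : ℝ) (v : Fin n → Bool) (o : Option (Fin n)) :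
    meanReward ε v (probe o) = 1 / 2 + o.elim 0 fun i => ε * if v i then 1 else -1 := by
  cases o <;> simp [meanReward, probe]

/-- The distribution of the reward label of the hard instance with parameter `u`. -/
def rewardWeight {n H : ℕ} {S : Type} (ε : ℝ) (u : Fin H × Fin n → Bool) (h : Fin H)
    (z : S × (Fin n → Bool)) : Bool → ℝ :=
  bernWeight (meanReward ε (fun i => u (h, i)) z.2)

section Affinity

variable {n H : ℕ} [NeZero n] {S : Type} {ξ : S → ℝ} {ε : ℝ}

lemma rewardWeight_mem_stdSimplex (hε : ε ∈ Set.Icc 0 (1 / (2 * n : ℝ)))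
    (u : Fin H × Fin n → Bool) (h : Fin H) (z : S × (Fin n → Bool)) :
    rewardWeight ε u h z ∈ stdSimplex ℝ Bool :=
  bernWeight_mem_stdSimplex (meanReward_mem_Icc hε _ _)

variable [Fintype S] (hξ : ξ ∈ stdSimplex ℝ S) (hε : ε ∈ Set.Icc 0 (1 / (2 * n : ℝ)))

include hξ in
lemma affinity_stepWeight (u u' : Fin H × Fin n → Bool) (h : Fin H) :
    affinity (MDP.stepWeight ξ (behavior n H S) (rewardWeight ε u) h)
        (MDP.stepWeight ξ (behavior n H S) (rewardWeight ε u') h) =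
      ∑ o, probeWeight n o *
        affinity (bernWeight (meanReward ε (fun i => u (h, i)) (probe o)))
          (bernWeight (meanReward ε (fun i => u' (h, i)) (probe o))) := by
  have hβ := compWeight_mem_stdSimplex hξ ((behavior n H S).2 h)
  rw [MDP.stepWeight, MDP.stepWeight, affinity_compWeight hβ.1]
  simp only [sum_compWeight_mul, behavior, rewardWeight]
  rw [← Finset.sum_mul, hξ.2, one_mul, sum_probeDist_mul]

include hξ hε in
lemma affinity_stepWeight_flipAt_of_ne (j : Fin H × Fin n) (u : Fin H × Fin n → Bool) {h : Fin H}
    (hj : h ≠ j.1) :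
    affinity (MDP.stepWeight ξ (behavior n H S) (rewardWeight ε u) h)
      (MDP.stepWeight ξ (behavior n H S) (rewardWeight ε (flipAt j u)) h) = 1 := by
  have hflip : rewardWeight ε (flipAt j u) h = rewardWeight (S := S) ε u h := by
    funext z
    simp only [rewardWeight, flipAt_of_ne fun hi : (h, _) = j => hj (congrArg Prod.fst hi)]
  rw [MDP.stepWeight, MDP.stepWeight, hflip]
  exact affinity_self (MDP.stepWeight_mem_stdSimplex hξ (rewardWeight_mem_stdSimplex hε u) h)

include hε in
lemma sq_le_one_quarter : ε ^ 2 ≤ 1 / 4 := by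
  have hn : (1 : ℝ) ≤ n := by exact_mod_cast NeZero.one_le
  have hhalf : ε ≤ 1 / 2 := hε.2.trans (by gcongr; linarith)
  calc ε ^ 2 ≤ (1 / 2) ^ 2 := pow_le_pow_left₀ hε.1 hhalf 2
    _ = 1 / 4 := by norm_num

include hε in
lemma le_affinity_bernWeight_probe_flipAt (j : Fin H × Fin n) (u : Fin H × Fin n → Bool)
    (o : Option (Fin n)) :
    1 - (if o = some j.2 then 4 * ε ^ 2 else 0) ≤
      affinity (bernWeight (meanReward ε (fun i => u (j.1, i)) (probe o)))
        (bernWeight (meanReward ε (fun i => flipAt j u (j.1, i)) (probe o))) := by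
  split_ifs with ho
  · have hmean := one_sub_le_affinity_bernWeight (sq_le_one_quarter hε)
    have hmean' := one_sub_le_affinity_bernWeight ((neg_sq ε).trans_le (sq_le_one_quarter hε))
    rw [neg_sq, sub_neg_eq_add] at hmean'
    subst ho
    simp only [meanReward_probe, Option.elim, flipAt_same]
    cases u j
    · simpa using hmean'
    · simpa [← sub_eq_add_neg] using hmean
  · have hsame : meanReward ε (fun i => flipAt j u (j.1, i)) (probe o) =
        meanReward ε (fun i => u (j.1, i)) (probe o) := by
      rw [meanReward_probe, meanReward_probe]
      cases o with
      | none => rfl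
      | some i =>
        have hi : (j.1, i) ≠ j := fun hi => ho (congrArg (some ·.2) hi)
        simp only [Option.elim, flipAt_of_ne hi]
    rw [hsame, affinity_self (bernWeight_mem_stdSimplex (meanReward_mem_Icc hε _ _)), sub_zero]

include hξ hε in
lemma le_affinity_stepWeight_flipAt (j : Fin H × Fin n) (u : Fin H × Fin n → Bool) :
    1 - 2 * ε ^ 2 / n ≤
      affinity (MDP.stepWeight ξ (behavior n H S) (rewardWeight ε u) j.1)
        (MDP.stepWeight ξ (behavior n H S) (rewardWeight ε (flipAt j u)) j.1) := by
  have hn : (n : ℝ) ≠ 0 := NeZero.ne _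
  rw [affinity_stepWeight hξ]
  calc 1 - 2 * ε ^ 2 / n
      = ∑ o, probeWeight n o * (1 - if o = some j.2 then 4 * ε ^ 2 else 0) := by
        simp only [sum_probeWeight_mul, Option.some_inj, Finset.sum_sub_distrib,
          Finset.sum_ite_eq', Finset.mem_univ, reduceCtorEq, if_true, if_false, Finset.sum_const,
          Finset.card_univ, Fintype.card_fin, nsmul_eq_mul]
        field_simp
        ring
    _ ≤ _ := Finset.sum_le_sum fun o _ => mul_le_mul_of_nonneg_left
        (le_affinity_bernWeight_probe_flipAt hε j u o) (probeWeight_nonneg o)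

include hξ hε in
lemma le_sum_min_dataWeight_flipAt {K : ℕ} (hK : 16 * K * ε ^ 2 ≤ n) (j : Fin H × Fin n)
    (u : Fin H × Fin n → Bool) :
    3 / 8 ≤ ∑ ω, min (MDP.dataWeight K ξ (behavior n H S) (rewardWeight ε u) ω)
      (MDP.dataWeight K ξ (behavior n H S) (rewardWeight ε (flipAt j u)) ω) := by
  have hn : (1 : ℝ) ≤ n := by exact_mod_cast NeZero.one_le
  have hstep := fun (u : Fin H × Fin n → Bool) (h : Fin H) =>
    MDP.stepWeight_mem_stdSimplex (β := behavior n H S) hξ (rewardWeight_mem_stdSimplex hε u) h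
  have hdata := fun (u : Fin H × Fin n → Bool) =>
    MDP.dataWeight_mem_stdSimplex (β := behavior n H S) (K := K) hξ
      (rewardWeight_mem_stdSimplex hε u)
  have haff : affinity (MDP.dataWeight K ξ (behavior n H S) (rewardWeight ε u))
      (MDP.dataWeight K ξ (behavior n H S) (rewardWeight ε (flipAt j u))) =
      affinity (MDP.stepWeight ξ (behavior n H S) (rewardWeight ε u) j.1)
        (MDP.stepWeight ξ (behavior n H S) (rewardWeight ε (flipAt j u)) j.1) ^ K := by
    rw [MDP.dataWeight, MDP.dataWeight, affinity_productWeight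
        (fun _ => (productWeight_mem_stdSimplex (hstep _)).1)
        fun _ => (productWeight_mem_stdSimplex (hstep _)).1,
      affinity_productWeight (fun h => (hstep _ h).1) fun h => (hstep _ h).1,
      Finset.prod_eq_single j.1 (fun h _ hj => affinity_stepWeight_flipAt_of_ne hξ hε j u hj)
        (by simp), Finset.prod_const, Finset.card_univ, Fintype.card_fin]
  have hdiv : 2 * ε ^ 2 / n ≤ 1 := by
    rw [div_le_one (by linarith)]
    linarith [sq_le_one_quarter hε]
  have hlow : 7 / 8 ≤ affinity (MDP.dataWeight K ξ (behavior n H S) (rewardWeight ε u))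
      (MDP.dataWeight K ξ (behavior n H S) (rewardWeight ε (flipAt j u))) :=
    calc 7 / 8 ≤ 1 + K * -(2 * ε ^ 2 / n) := by
          have : K * (2 * ε ^ 2 / n) ≤ 1 / 8 := by
            rw [← mul_div_assoc, div_le_iff₀ (by linarith)]
            linarith
          linarith
      _ ≤ (1 - 2 * ε ^ 2 / n) ^ K := one_add_mul_le_pow (by linarith) K
      _ ≤ _ := haff ▸ pow_le_pow_left₀ (sub_nonneg.2 hdiv)
          (le_affinity_stepWeight_flipAt hξ hε j u) K
  nlinarith [sq_affinity_le_two_mul_sum_min (hdata u) (hdata (flipAt j u))]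

end Affinity

/-! ### The regret of the hard instances -/

section Regret

variable {n H : ℕ} {S : Type} [Fintype S] {ξ : S → ℝ}

/-- The probability that the bit `j.2` of the action of `π` in step `j.1` differs from `b`. -/
def mismatchProb (ξ : S → ℝ) (π : Policy H S (Fin n → Bool)) (j : Fin H × Fin n) (b : Bool) : ℝ :=
  ∑ x, ξ x * ∑ a, π.1 j.1 x a * if a j.2 = b then 0 else 1

lemma mismatchProb_nonneg (hξ : ξ ∈ stdSimplex ℝ S) (π : Policy H S (Fin n → Bool))
    (j : Fin H × Fin n) (b : Bool) : 0 ≤ mismatchProb ξ π j b :=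
  Finset.sum_nonneg fun x _ => mul_nonneg (hξ.1 x) <| Finset.sum_nonneg fun a _ =>
    mul_nonneg ((π.2 j.1 x).1 a) (by split_ifs <;> norm_num)

lemma mismatchProb_add_not (hξ : ξ ∈ stdSimplex ℝ S) (π : Policy H S (Fin n → Bool))
    (j : Fin H × Fin n) (b : Bool) : mismatchProb ξ π j b + mismatchProb ξ π j (!b) = 1 := by
  have hbit : ∀ a : Fin n → Bool,
      (if a j.2 = b then 0 else 1 : ℝ) + (if a j.2 = !b then 0 else 1) = 1 := fun a => by
    cases a j.2 <;> cases b <;> simp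
  simp only [mismatchProb, ← Finset.sum_add_distrib, ← mul_add, hbit, mul_one, (π.2 _ _).2, hξ.2]

variable [NeZero n] {ε : ℝ} (hξ : ξ ∈ stdSimplex ℝ S) (hε : ε ∈ Set.Icc 0 (1 / (2 * n : ℝ)))

lemma sum_mul_suboptimality_hardMDP (u : Fin H × Fin n → Bool) (π : Policy H S (Fin n → Bool)) :
    ∑ x, ξ x * ((hardMDP hξ hε u).optValue 0 x - (hardMDP hξ hε u).value π 0 x) =
      ε * ∑ j, mismatchProb ξ π j (u j) := by
  rw [MDP.sum_mul_suboptimality (hardMDP_hasIIDStates hξ hε u) hξ.2 (hardMDP_r_le hξ hε u)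
    (hardMDP_r_self hξ hε u)]
  simp only [hardMDP_r, bestReward_sub_meanReward, mismatchProb, Fintype.sum_prod_type,
    Finset.mul_sum]
  refine Finset.sum_congr rfl fun h _ => ?_
  refine (Finset.sum_congr rfl fun x _ => Finset.sum_comm).trans (Finset.sum_comm.trans ?_)
  simp only [mul_left_comm _ ε]

variable [MeasurableSpace S] [MeasurableSingletonClass S]

lemma exists_le_expSubopt_hardMDP {K : ℕ} (hK : 16 * K * ε ^ 2 ≤ n)
    (alg : Dataset K H S (Fin n → Bool) → Policy H S (Fin n → Bool)) :
    ∃ u, 3 / 16 * ε * (H * n) ≤ (hardMDP hξ hε u).expSubopt ξ (behavior n H S) alg := by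
  obtain ⟨u, hu⟩ := exists_assouad
    (e := fun j ω b => mismatchProb ξ (alg (MDP.toDataset bit ω)) j b)
    (fun _ _ _ => mismatchProb_nonneg hξ _ _ _) (fun _ _ _ => mismatchProb_add_not hξ _ _ _)
    (le_sum_min_dataWeight_flipAt hξ hε hK)
  refine ⟨u, ?_⟩
  rw [MDP.expSubopt_eq_sum (hardMDP_hasIIDStates hξ hε u) hξ (rewardWeight_mem_stdSimplex hε u)
    fun _ _ _ => rfl]
  simp only [sum_mul_suboptimality_hardMDP, mul_left_comm _ ε, ← Finset.mul_sum]
  rw [Fintype.card_prod, Fintype.card_fin, Fintype.card_fin, Nat.cast_mul] at hu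
  linarith [mul_le_mul_of_nonneg_left hu hε.1]

end Regret

/-! ### Concentration of the visit counts -/

section Concentration

variable {n H K : ℕ} [NeZero n] {S : Type} [Fintype S] {ξ : S → ℝ} {ε : ℝ} {δ : ℝ}

lemma inv_two_mul_le_probeWeight (o : Option (Fin n)) : 1 / (2 * n) ≤ probeWeight n o := by
  cases o with
  | none =>
    have hn : (1 : ℝ) ≤ n := by exact_mod_cast NeZero.one_le
    exact one_div_le_one_div_of_le two_pos (by linarith)
  | some i => rfl

lemma sum_stepWeight_behavior_eq_probe {Y : Type} [Fintype Y]
    {κ : Fin H → S × (Fin n → Bool) → Y → ℝ} (hξ : ξ ∈ stdSimplex ℝ S)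
    (hκ : ∀ h z, κ h z ∈ stdSimplex ℝ Y) (h : Fin H) (o : Option (Fin n)) :
    ∑ y with y.1.2 = probe o, MDP.stepWeight ξ (behavior n H S) κ h y = probeWeight n o := by
  simp only [sum_filter_eq_sum_mul_boole, MDP.stepWeight, sum_compWeight_mul, ← Finset.sum_mul,
    (hκ _ _).2, one_mul, behavior, sum_probeDist_mul, probe_injective.eq_iff]
  simp [hξ.2]

lemma exp_neg_visit_le (hδ : 0 < δ) (hK : 20 * (n + 1) * Real.log (H * (n + 1) / δ) ≤ K)
    (hH : 0 < H) (o : Option (Fin n)) :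
    Real.exp (-(K * probeWeight n o / 10)) ≤ δ / (H * (n + 1)) := by
  have hn : (0 : ℝ) < n := by exact_mod_cast NeZero.pos n
  have hlog : Real.log (H * (n + 1) / δ) ≤ K * probeWeight n o / 10 :=
    calc Real.log (H * (n + 1) / δ) ≤ K / (20 * (n + 1)) := by
          rw [le_div_iff₀ (by positivity)]
          linarith
      _ ≤ K / (20 * n) := by
          gcongr
          linarith
      _ = K * (1 / (2 * n)) / 10 := by
          field_simp
          ring
      _ ≤ K * probeWeight n o / 10 := by
          gcongr
          exact inv_two_mul_le_probeWeight o
  calc Real.exp (-(K * probeWeight n o / 10)) ≤ Real.exp (-Real.log (H * (n + 1) / δ)) := by gcongr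
    _ = δ / (H * (n + 1)) := by rw [Real.exp_neg, Real.exp_log (by positivity), inv_div]

lemma sum_dataWeight_visits_lt_le (hξ : ξ ∈ stdSimplex ℝ S)
    (hε : ε ∈ Set.Icc 0 (1 / (2 * n : ℝ))) (u : Fin H × Fin n → Bool) (h : Fin H)
    (o : Option (Fin n)) :
    ∑ ω with (Finset.card {τ | (ω τ h).1.2 = probe o} : ℝ) < K * probeWeight n o / 2,
      MDP.dataWeight K ξ (behavior n H S) (rewardWeight ε u) ω ≤
      Real.exp (-(K * probeWeight n o / 10)) := by
  have hκ := rewardWeight_mem_stdSimplex (S := S) hε u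
  have hstep := MDP.stepWeight_mem_stdSimplex (β := behavior n H S) hξ hκ
  have hmarginal : probeWeight n o ≤
      ∑ s with (s h).1.2 = probe o,
        productWeight (MDP.stepWeight ξ (behavior n H S) (rewardWeight ε u)) s := by
    rw [← sum_stepWeight_behavior_eq_probe hξ hκ h o, sum_filter_eq_sum_mul_boole,
      sum_filter_eq_sum_mul_boole]
    exact (sum_productWeight_mul_apply (fun h => (hstep h).2) _ h).ge
  simpa only [MDP.dataWeight, Fintype.card_fin] using
    sum_productWeight_card_lt_le (ι := Fin K) (productWeight_mem_stdSimplex hstep) hmarginal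

lemma le_dataLaw_isCovered [MeasurableSpace S] [MeasurableSingletonClass S]
    (hξ : ξ ∈ stdSimplex ℝ S) (hε : ε ∈ Set.Icc 0 (1 / (2 * n : ℝ))) (u : Fin H × Fin n → Bool)
    (hδ : 0 < δ) (hK : 20 * (n + 1) * Real.log (H * (n + 1) / δ) ≤ K) :
    ENNReal.ofReal (1 - δ) ≤
      (hardMDP hξ hε u).dataLaw K ξ (behavior n H S) {D | IsCovered D} := by
  have hκ := rewardWeight_mem_stdSimplex (S := S) hε u
  have hdata := MDP.dataWeight_mem_stdSimplex (β := behavior n H S) (K := K) hξ hκ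
  have hunion := one_sub_sum_le_sum_filter_forall_not hdata (ι := Fin H × Option (Fin n))
    fun i => (sum_dataWeight_visits_lt_le hξ hε u i.1 i.2).trans
      (exp_neg_visit_le hδ hK (Fin.pos i.1) i.2)
  have hfail : ∑ _i : Fin H × Option (Fin n), δ / (H * (n + 1)) ≤ δ := by
    rw [Finset.sum_const, Finset.card_univ, Fintype.card_prod, Fintype.card_option,
      Fintype.card_fin, Fintype.card_fin, nsmul_eq_mul]
    push_cast
    exact (mul_div_left_comm _ _ _).trans_le
      (mul_le_of_le_one_right hδ.le (div_self_le_one _))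
  rw [MDP.dataLaw_eq_weightedDirac (hardMDP_hasIIDStates hξ hε u) hξ hκ fun _ _ _ => rfl]
  refine (ENNReal.ofReal_le_ofReal ((sub_le_sub_left hfail 1).trans hunion)).trans
    (ofReal_sum_le_weightedDirac_apply hdata.1 fun ω hω h o => ?_)
  exact not_lt.1 ((Finset.mem_filter.1 hω).2 (h, o))

end Concentration

/-! ### Calibration of the gap -/

section Gap

variable {n H K : ℕ}

/-- The reward gap of the hard instances, the largest order at which `K` trajectories cannot tell
neighbouring instances apart. -/
def hardGap (n K : ℕ) : ℝ := √(n / K) / 4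

lemma sq_hardGap (n K : ℕ) : hardGap n K ^ 2 = n / K / 16 := by
  rw [hardGap, div_pow, Real.sq_sqrt (by positivity)]
  norm_num

lemma mul_sq_hardGap_le (n K : ℕ) : 16 * K * hardGap n K ^ 2 ≤ n := by
  rw [sq_hardGap]
  calc 16 * K * ((n : ℝ) / K / 16) = n * (K / K) := by ring
    _ ≤ n := mul_le_of_le_one_right (Nat.cast_nonneg n) (div_self_le_one _)

lemma hardGap_mem_Icc [NeZero n] (hK : (n : ℝ) ^ 3 ≤ 4 * K) :
    hardGap n K ∈ Set.Icc 0 (1 / (2 * n : ℝ)) := by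
  have hn : (0 : ℝ) < n := by exact_mod_cast NeZero.pos n
  have hK0 : (0 : ℝ) < K := by linarith [pow_pos hn 3]
  refine ⟨by unfold hardGap; positivity, le_of_sq_le_sq ?_ (by positivity)⟩
  rw [sq_hardGap, div_div, div_pow, div_le_div_iff₀ (by positivity) (by positivity)]
  linarith

lemma sqrt_mul_sqrt_le_hardGap [NeZero n] (K : ℕ) :
    √((n + 1 : ℕ) : ℝ) * √(8 * n ^ 2 / K) ≤ 16 * (n * hardGap n K) := by
  have hn : (1 : ℝ) ≤ n := by exact_mod_cast NeZero.one_le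
  have hgap : 0 ≤ hardGap n K := by unfold hardGap; positivity
  rw [← Real.sqrt_mul (Nat.cast_nonneg _), Real.sqrt_le_left (by positivity)]
  calc ((n + 1 : ℕ) : ℝ) * (8 * n ^ 2 / K) ≤ (2 * n) * (8 * n ^ 2 / K) := by
        gcongr
        push_cast
        linarith
    _ = (16 * (n * hardGap n K)) ^ 2 := by
        rw [mul_pow, mul_pow, sq_hardGap]
        ring

end Gap

section LowerBound

variable {n H K : ℕ} [NeZero n] {S : Type} [Fintype S] {ξ : S → ℝ} {ε : ℝ}
  (hξ : ξ ∈ stdSimplex ℝ S)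

lemma IsCovered.sum_expect_wnorm_le (hε : ε ∈ Set.Icc 0 (1 / (2 * n : ℝ)))
    (u : Fin H × Fin n → Bool) {D : Dataset K H S (Fin n → Bool)} (hD : IsCovered D) (hK : 0 < K)
    {lam : ℝ} (hlam : 0 < lam) (π : Policy H S (Fin n → Bool)) :
    ∑ h, (hardMDP hξ hε u).expect ξ π h (fun _ a =>
      wnorm ((hardMDP hξ hε u).Zstar (fun _ => feature) lam D h)⁻¹ (feature a)) ≤
      H * √(8 * n ^ 2 / K) := by
  calc _ ≤ ∑ _h : Fin H, √(8 * n ^ 2 / K : ℝ) := Finset.sum_le_sum fun h _ =>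
        MDP.expect_le (hardMDP_hasIIDStates hξ hε u) hξ π h fun _ a =>
          hD.wnorm_Zstar_inv_le hξ hε u hK hlam h a
    _ = H * √(8 * n ^ 2 / K) := by simp

variable [MeasurableSpace S] [MeasurableSingletonClass S]

lemma le_iSup_expSubopt_hardMDP (hε : ε ∈ Set.Icc 0 (1 / (2 * n : ℝ)))
    (hK : 16 * K * ε ^ 2 ≤ n)
    (alg : Dataset K H S (Fin n → Bool) → Policy H S (Fin n → Bool)) :
    3 / 16 * ε * (H * n) ≤ ⨆ M : Set.range (hardMDP (H := H) hξ hε),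
      M.1.expSubopt ξ (behavior n H S) alg := by
  obtain ⟨u, hu⟩ := exists_le_expSubopt_hardMDP hξ hε hK alg
  exact hu.trans (le_ciSup (f := fun M : Set.range (hardMDP (H := H) hξ hε) =>
    M.1.expSubopt ξ (behavior n H S) alg) (Set.finite_range _).bddAbove ⟨_, u, rfl⟩)

lemma IsCovered.mul_sum_expect_wnorm_le_iSup_expSubopt
    (hε : hardGap n K ∈ Set.Icc 0 (1 / (2 * n : ℝ))) (u : Fin H × Fin n → Bool)
    {D : Dataset K H S (Fin n → Bool)} (hD : IsCovered D) (hK : 0 < K) {lam : ℝ} (hlam : 0 < lam)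
    (π : Policy H S (Fin n → Bool))
    (alg : Dataset K H S (Fin n → Bool) → Policy H S (Fin n → Bool)) :
    1 / 100 * √((n + 1 : ℕ) : ℝ) * ∑ h, (hardMDP hξ hε u).expect ξ π h (fun _ a =>
      wnorm ((hardMDP hξ hε u).Zstar (fun _ => feature) lam D h)⁻¹ (feature a)) ≤
      ⨆ M : Set.range (hardMDP (H := H) hξ hε), M.1.expSubopt ξ (behavior n H S) alg := by
  have hgap : 0 ≤ hardGap n K * (H * n) := mul_nonneg hε.1 (by positivity)
  calc _ ≤ 1 / 100 * √((n + 1 : ℕ) : ℝ) * (H * √(8 * n ^ 2 / K)) := by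
        gcongr
        exact hD.sum_expect_wnorm_le hξ hε u hK hlam π
    _ = 1 / 100 * H * (√((n + 1 : ℕ) : ℝ) * √(8 * n ^ 2 / K)) := by ring
    _ ≤ 1 / 100 * H * (16 * (n * hardGap n K)) :=
        mul_le_mul_of_nonneg_left (sqrt_mul_sqrt_le_hardGap K) (by positivity)
    _ ≤ 3 / 16 * hardGap n K * (H * n) := by linarith
    _ ≤ _ := le_iSup_expSubopt_hardMDP hξ hε (mul_sq_hardGap_le n K) alg

end LowerBound

/-! ### The sample size -/

lemma one_le_log_two_mul_div {H d : ℕ} {δ : ℝ} (hH : 1 ≤ H) (hd : 2 ≤ d) (hδ : 0 < δ)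
    (hδ1 : δ < 1) : 1 ≤ Real.log (2 * H * d / δ) := by
  have hH' : (1 : ℝ) ≤ H := by exact_mod_cast hH
  have hd' : (2 : ℝ) ≤ d := by exact_mod_cast hd
  rw [Real.le_log_iff_exp_le (by positivity), le_div_iff₀ hδ]
  calc Real.exp 1 * δ ≤ Real.exp 1 := mul_le_of_le_one_right (Real.exp_pos 1).le hδ1.le
    _ ≤ 2 * 1 * 2 := by linarith [Real.exp_one_lt_d9]
    _ ≤ 2 * H * d := by gcongr

lemma sample_size_bounds {H d K : ℕ} {δ : ℝ} (hH : 1 ≤ H) (hd : 2 ≤ d) (hδ : 0 < δ) (hδ1 : δ < 1)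
    (hK : 20 * (d : ℝ) ^ 4 * Real.log (2 * H * d / δ) ≤ K) :
    (d : ℝ) ^ 3 ≤ 4 * K ∧ 20 * d * Real.log (H * d / δ) ≤ K := by
  have hH' : (1 : ℝ) ≤ H := by exact_mod_cast hH
  have hd' : (1 : ℝ) ≤ d := by exact_mod_cast one_le_two.trans hd
  have hlog := one_le_log_two_mul_div hH hd hδ hδ1
  constructor
  · have hK1 : 20 * (d : ℝ) ^ 4 ≤ K := (le_mul_of_one_le_right (by positivity) hlog).trans hK
    linarith [pow_le_pow_right₀ hd' (by norm_num : 3 ≤ 4), pow_nonneg (zero_le_one.trans hd') 4]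
  · calc 20 * (d : ℝ) * Real.log (H * d / δ) ≤ 20 * d * Real.log (2 * H * d / δ) := by
          gcongr
          linarith
      _ ≤ 20 * d ^ 4 * Real.log (2 * H * d / δ) := by
          gcongr
          exact le_self_pow₀ hd' (by norm_num)
      _ ≤ K := hK

end OfflineRL

end

theorem theorem3_general {S : Type} [Fintype S] [MeasurableSpace S] [MeasurableSingletonClass S]
    {ξ : S → ℝ} (hξ : ξ ∈ stdSimplex ℝ S) {H d K : ℕ} {δ : ℝ} (hd : 2 ≤ d) (hδ : 0 < δ)
    (hKd : (d : ℝ) ^ 3 ≤ 4 * K) (hKδ : 20 * d * Real.log (H * d / δ) ≤ K) :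
    ∃ (A : Type) (_ : Fintype A) (_ : MeasurableSpace A) (_ : MeasurableSingletonClass A)
      (φ : S → A → EuclideanSpace ℝ (Fin d)) (β : OfflineRL.Policy H S A)
      (𝓜 : Set (OfflineRL.MDP H S A)),
      𝓜.Nonempty ∧ (∀ M ∈ 𝓜, M.IsLinear φ) ∧
      (∀ M ∈ 𝓜, ∀ h : Fin H, (M.covMatrix φ ξ β h -
        (1 / 12 / (d : ℝ) ^ 2) • (1 : Matrix (Fin d) (Fin d) ℝ)).PosSemidef) ∧
      (∀ M ∈ 𝓜, ∃ πs, M.IsOptimal πs) ∧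
      ∀ (alg : OfflineRL.Dataset K H S A → OfflineRL.Policy H S A) (lam : ℝ), 0 < lam →
        ∀ M ∈ 𝓜, ∀ π : OfflineRL.Policy H S A,
          ENNReal.ofReal (1 - δ) ≤ M.dataLaw K ξ β
            {D | 1 / 100 * √(d : ℝ) * ∑ h : Fin H, M.expect ξ π h
                    (fun x a => OfflineRL.wnorm (M.Zstar φ lam D h)⁻¹ (φ x a)) ≤
                  ⨆ M' : 𝓜, M'.1.expSubopt ξ β alg} := by
  obtain ⟨n, rfl⟩ : ∃ n, d = n + 1 := ⟨d - 1, by omega⟩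
  have : NeZero n := ⟨by omega⟩
  push_cast at hKd hKδ
  have hε := OfflineRL.hardGap_mem_Icc
    ((pow_le_pow_left₀ n.cast_nonneg (le_add_of_nonneg_right zero_le_one) 3).trans hKd)
  have hK : 0 < K := by
    have : (0 : ℝ) < 4 * K := lt_of_lt_of_le (by positivity) hKd
    exact_mod_cast pos_of_mul_pos_right this zero_le_four
  refine ⟨Fin n → Bool, inferInstance, inferInstance, inferInstance, fun _ => OfflineRL.feature,
    OfflineRL.behavior n H S, Set.range (OfflineRL.hardMDP hξ hε), Set.range_nonempty _,
    Set.forall_mem_range.2 (OfflineRL.isLinear_hardMDP hξ hε),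
    Set.forall_mem_range.2 (OfflineRL.covMatrix_hardMDP_sub_smul_one_posSemidef hξ hε),
    Set.forall_mem_range.2 (OfflineRL.exists_isOptimal_hardMDP hξ hε),
    fun alg lam hlam => Set.forall_mem_range.2 fun u π => ?_⟩
  exact (OfflineRL.le_dataLaw_isCovered hξ hε u hδ hKδ).trans <| measure_mono fun D hD =>
    OfflineRL.IsCovered.mul_sum_expect_wnorm_le_iSup_expSubopt hξ hε u hD hK hlam π alg

theorem theorem3 :
    ∃ c c₀ C : ℝ, 0 < c ∧ 0 < c₀ ∧ 0 < C ∧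
      ∀ (H d K : ℕ) (δ : ℝ), 1 ≤ H → 2 ≤ d → 0 < δ → δ < 1 →
        C * (d : ℝ) ^ 4 * Real.log (2 * (H : ℝ) * (d : ℝ) / δ) ≤ (K : ℝ) →
        ∃ (S A : Type) (_ : Fintype S) (_ : Fintype A)
          (_ : MeasurableSpace S) (_ : MeasurableSingletonClass S)
          (_ : MeasurableSpace A) (_ : MeasurableSingletonClass A)
          (φ : S → A → EuclideanSpace ℝ (Fin d))
          (ξ : S → ℝ) (β : OfflineRL.Policy H S A) (𝓜 : Set (OfflineRL.MDP H S A)),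
          ξ ∈ stdSimplex ℝ S ∧ 𝓜.Nonempty ∧
          (∀ M ∈ 𝓜, M.IsLinear φ) ∧
          (∀ M ∈ 𝓜, ∀ h : Fin H,
            (M.covMatrix φ ξ β h -
              (c₀ / (d : ℝ) ^ 2) • (1 : Matrix (Fin d) (Fin d) ℝ)).PosSemidef) ∧
          (∀ M ∈ 𝓜, ∃ πs : OfflineRL.Policy H S A, M.IsOptimal πs) ∧
          ∀ alg : OfflineRL.Dataset K H S A → OfflineRL.Policy H S A, Measurable alg →
          ∀ lam : ℝ, 0 < lam →
          ∀ M ∈ 𝓜, ∀ πs : OfflineRL.Policy H S A, M.IsOptimal πs →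
            ENNReal.ofReal (1 - δ) ≤ M.dataLaw K ξ β
              {D | c * √(d : ℝ) * ∑ h : Fin H, M.expect ξ πs h
                      (fun x a => OfflineRL.wnorm (M.Zstar φ lam D h)⁻¹ (φ x a)) ≤
                    ⨆ M' : 𝓜, M'.1.expSubopt ξ β alg} := by
  refine ⟨1 / 100, 1 / 12, 20, by norm_num, by norm_num, by norm_num,
    fun H d K δ hH hd hδ hδ1 hK => ?_⟩
  obtain ⟨hKd, hKδ⟩ := OfflineRL.sample_size_bounds hH hd hδ hδ1 hK
  have hξ : (fun _ => 1 / 2) ∈ stdSimplex ℝ Bool := ⟨fun _ => by norm_num, by norm_num⟩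
  obtain ⟨A, _, _, _, φ, β, 𝓜, hne, hlin, hcov, hopt, hlow⟩ := theorem3_general hξ hd hδ hKd hKδ
  exact ⟨Bool, A, inferInstance, inferInstance, inferInstance, inferInstance, inferInstance,
    inferInstance, φ, _, β, 𝓜, hξ, hne, hlin, hcov, hopt,
    fun alg _ lam hlam M hM πs _ => hlow alg lam hlam M hM πs⟩
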